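/- Fix an integer $n\ge 4$. Let $\mathscr C_B(\mathbb R^n)$ be the (finite-dimensional) vector space of algebraic curvature tensors on $\mathbb R^n$, i.e. of arrays $R=(R_{ijkl})_{1\le i,j,k,l\le n}$ of real numbers with $R_{ijkl}=-R_{jikl}=-R_{ijlk}=R_{klij}$ and $R_{ijkl}+R_{iklj}+R_{iljk}=0$. The Ricci tensor of $R$ is $\mathrm{Ric}_{ik}=\sum_j R_{ijkj}$ and its scalar curvature is $\sum_{i,j}R_{ijij}$. The group $O(n)$ acts on $\mathscr C_B(\mathbb R^n)$ by $(A\cdot R)_{ijkl}=\sum_{a,b,c,d}A_{ia}A_{jb}A_{kc}A_{ld}R_{abcd}$. For $R\in\mathscr C_B(\mathbb R^n)$ let $Q(R)\in\mathscr C_B(\mathbb R^n)$ be given by $$Q(R)_{ijkl}=\sum_{p,q=1}^n R_{ijpq}R_{klpq}+2\sum_{p,q=1}^n\bigl(R_{ipkq}R_{jplq}-R_{iplq}R_{jpkq}\bigr).$$ Let $C\subset\mathscr C_B(\mathbb R^n)$ be a cone (that is, $tR\in C$ whenever $R\in C$ and $t>0$) with the following properties: (i) $C$ is closed, convex, and $O(n)$-invariant.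 (ii) $C$ is invariant under the Hamilton ODE $\frac{d}{dt}R=Q(R)$: if $R:[0,T]\to\mathscr C_B(\mathbb R^n)$ is a solution with $R(0)\in C$, then $R(t)\in C$ for all $t\in[0,T]$. (iii) If $R\in C\setminus\{0\}$, then the scalar curvature of $R$ is nonnegative and the Ricci tensor of $R$ is non-zero. (iv) The curvature tensor $I_{ijkl}=\delta_{ik}\delta_{jl}-\delta_{il}\delta_{jk}$ lies in the interior of $C$ (relative to $\mathscr C_B(\mathbb R^n)$). Let $(M,g)$ be a compact smooth Riemannian manifold of dimension $n$ (without boundary) which is Einstein, i.e. $\mathrm{Ric}=\rho\,g$ for some constant $\rho\in\mathbb R$. Let its curvature tensor be normalized so that $R(u,v,u,v)$ is the sectional curvature of the plane spanned by orthonormal vectors $u,v$. Suppose that the curvature tensor of $(M,g)$ lies in the interior of $C$ at every point $p\in M$, where $T_pM$ is identified with $\mathbb R^n$ by an orthonormal basis (by (i) the choice does not matter). Then $(M,g)$ has constant sectional curvature. -/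

import Mathlib

open scoped Manifold ContDiff Topology Bundle

noncomputable section

namespace EinsteinCone

/-! ### Algebraic curvature tensors on `ℝⁿ` -/

/-- The space of algebraic curvature tensors on `ℝⁿ`, described by their components with respect
to the standard basis: skew-symmetry in the first and in the last pair, symmetry under exchange of
the pairs, and the first Bianchi identity. -/
def algCurv (n : ℕ) : Submodule ℝ (Fin n → Fin n → Fin n → Fin n → ℝ) where
  carrier := {R | (∀ i j k l, R i j k l = -R j i k l) ∧ (∀ i j k l, R i j k l = -R i j l k) ∧
    (∀ i j k l, R i j k l = R k l i j) ∧
    (∀ i j k l, R i j k l + R i k l j + R i l j k = 0)}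
  add_mem' := by
    rintro R S ⟨h1, h2, h3, h4⟩ ⟨k1, k2, k3, k4⟩
    refine ⟨fun i j k l ↦ ?_, fun i j k l ↦ ?_, fun i j k l ↦ ?_, fun i j k l ↦ ?_⟩ <;>
      simp only [Pi.add_apply]
    · linarith [h1 i j k l, k1 i j k l]
    · linarith [h2 i j k l, k2 i j k l]
    · linarith [h3 i j k l, k3 i j k l]
    · linarith [h4 i j k l, k4 i j k l]
  zero_mem' := by simp
  smul_mem' := by
    rintro c R ⟨h1, h2, h3, h4⟩
    refine ⟨fun i j k l ↦ ?_, fun i j k l ↦ ?_, fun i j k l ↦ ?_, fun i j k l ↦ ?_⟩ <;>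
      simp only [Pi.smul_apply, smul_eq_mul]
    · rw [h1 i j k l]; ring
    · rw [h2 i j k l]; ring
    · rw [h3 i j k l]
    · rw [← mul_add, ← mul_add, h4 i j k l, mul_zero]

/-- The components `Q(R)_{ijkl}` of the quadratic expression in the Hamilton ODE. -/
def hamiltonFun {n : ℕ} (R : Fin n → Fin n → Fin n → Fin n → ℝ) :
    Fin n → Fin n → Fin n → Fin n → ℝ := fun i j k l ↦
  ∑ p, ∑ q, R i j p q * R k l p q
    + 2 * ∑ p, ∑ q, (R i p k q * R j p l q - R i p l q * R j p k q)

theorem hamiltonFun_mem {n : ℕ} {R : Fin n → Fin n → Fin n → Fin n → ℝ} (hR : R ∈ algCurv n) :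
    hamiltonFun R ∈ algCurv n := by
  obtain ⟨h1, h2, h3, h4⟩ := hR
  set D : Fin n → Fin n → Fin n → Fin n → ℝ := fun i j k l ↦ ∑ p, ∑ q, R i p j q * R k p l q
    with hD
  have D1 : ∀ i j k l, D i j k l = D k l i j := fun i j k l ↦ by
    simp only [hD, mul_comm]
  have D2 : ∀ i j k l, D i j k l = D j i l k := fun i j k l ↦ by
    simp only [hD]
    rw [Finset.sum_comm]
    refine Finset.sum_congr rfl fun p _ ↦ Finset.sum_congr rfl fun q _ ↦ ?_
    rw [h3 i q j p, h3 k q l p]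
  have key : ∀ i j k l, hamiltonFun R i j k l =
      2 * (D i j k l - D i j l k + D i k j l - D i l j k) := fun i j k l ↦ by
    have e1 : ∀ a b p q, R a b p q = R a p b q - R a q b p := fun a b p q ↦ by
      have := h4 a b p q
      rw [h2 a p q b] at this
      linarith
    have e2 : ∑ p, ∑ q, R i q j p * R k q l p = D i j k l := by
      rw [Finset.sum_comm]
    have e3 : ∑ p, ∑ q, R i p j q * R k q l p = D i j l k := by
      simp only [hD]
      refine Finset.sum_congr rfl fun p _ ↦ Finset.sum_congr rfl fun q _ ↦ ?_
      rw [h3 k q l p]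
    have e4 : ∑ p, ∑ q, R i q j p * R k p l q = D i j l k := by
      simp only [hD]
      rw [Finset.sum_comm]
      refine Finset.sum_congr rfl fun p _ ↦ Finset.sum_congr rfl fun q _ ↦ ?_
      rw [h3 k q l p]
    have e5 : ∑ p, ∑ q, R i j p q * R k l p q =
        ∑ p, ∑ q, R i p j q * R k p l q - ∑ p, ∑ q, R i p j q * R k q l p
          - ∑ p, ∑ q, R i q j p * R k p l q + ∑ p, ∑ q, R i q j p * R k q l p := by
      simp only [← Finset.sum_sub_distrib, ← Finset.sum_add_distrib]
      refine Finset.sum_congr rfl fun p _ ↦ Finset.sum_congr rfl fun q _ ↦ ?_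
      rw [e1 i j p q, e1 k l p q]
      ring
    rw [e2, e3, e4] at e5
    simp only [hamiltonFun, e5, Finset.sum_sub_distrib]
    simp only [hD]
    ring
  refine ⟨fun i j k l ↦ ?_, fun i j k l ↦ ?_, fun i j k l ↦ ?_, fun i j k l ↦ ?_⟩ <;>
    simp only [key]
  · linarith [D2 i j k l, D2 i j l k, D1 j k i l, D1 j l i k]
  · ring
  · linarith [D1 i j k l, D1 i j l k, D2 i j l k, D2 i k j l, D2 i l j k, D1 l i k j, D2 k l j i,
      D1 k l i j, D1 k l j i]
  · linarith

/-- The map `Q` on algebraic curvature tensors. -/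
def hamiltonQ {n : ℕ} (R : algCurv n) : algCurv n := ⟨hamiltonFun R.1, hamiltonFun_mem R.2⟩

/-- The components of the curvature tensor obtained from `R` by the linear change of frame `A`. -/
def rotateFun {n : ℕ} (A : Matrix (Fin n) (Fin n) ℝ) (R : Fin n → Fin n → Fin n → Fin n → ℝ) :
    Fin n → Fin n → Fin n → Fin n → ℝ := fun i j k l ↦
  ∑ a, ∑ b, ∑ c, ∑ d, A i a * A j b * A k c * A l d * R a b c d

theorem rotateFun_mem {n : ℕ} (A : Matrix (Fin n) (Fin n) ℝ)
    {R : Fin n → Fin n → Fin n → Fin n → ℝ} (hR : R ∈ algCurv n) : rotateFun A R ∈ algCurv n := by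
  obtain ⟨h1, h2, h3, h4⟩ := hR
  have swap : ∀ f : Fin n → Fin n → Fin n → Fin n → ℝ,
      ∑ a, ∑ b, ∑ c, ∑ d, f a b c d = ∑ a, ∑ b, ∑ c, ∑ d, f a c d b := fun f ↦ by
    refine Finset.sum_congr rfl fun a _ ↦ ?_
    calc ∑ b, ∑ c, ∑ d, f a b c d = ∑ b, ∑ d, ∑ c, f a b c d :=
          Finset.sum_congr rfl fun b _ ↦ Finset.sum_comm
      _ = ∑ d, ∑ b, ∑ c, f a b c d := Finset.sum_comm
  have swap2 : ∀ f : Fin n → Fin n → Fin n → Fin n → ℝ,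
      ∑ a, ∑ b, ∑ c, ∑ d, f a b c d = ∑ a, ∑ b, ∑ c, ∑ d, f b a c d := fun f ↦ Finset.sum_comm
  have swap3 : ∀ f : Fin n → Fin n → Fin n → Fin n → ℝ,
      ∑ a, ∑ b, ∑ c, ∑ d, f a b c d = ∑ a, ∑ b, ∑ c, ∑ d, f a b d c := fun f ↦
    Finset.sum_congr rfl fun a _ ↦ Finset.sum_congr rfl fun b _ ↦ Finset.sum_comm
  refine ⟨fun i j k l ↦ ?_, fun i j k l ↦ ?_, fun i j k l ↦ ?_, fun i j k l ↦ ?_⟩ <;>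
    simp only [rotateFun]
  · rw [swap2]
    simp only [← Finset.sum_neg_distrib]
    refine Finset.sum_congr rfl fun a _ ↦ Finset.sum_congr rfl fun b _ ↦
      Finset.sum_congr rfl fun c _ ↦ Finset.sum_congr rfl fun d _ ↦ ?_
    rw [h1 b a c d]; ring
  · rw [swap3]
    simp only [← Finset.sum_neg_distrib]
    refine Finset.sum_congr rfl fun a _ ↦ Finset.sum_congr rfl fun b _ ↦
      Finset.sum_congr rfl fun c _ ↦ Finset.sum_congr rfl fun d _ ↦ ?_
    rw [h2 a b d c]; ring
  · have swap4 : ∀ f : Fin n → Fin n → Fin n → Fin n → ℝ,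
        ∑ a, ∑ b, ∑ c, ∑ d, f a b c d = ∑ a, ∑ b, ∑ c, ∑ d, f c d a b := fun f ↦ by
      rw [swap, swap2, swap, swap2]
    rw [swap4]
    refine Finset.sum_congr rfl fun a _ ↦ Finset.sum_congr rfl fun b _ ↦
      Finset.sum_congr rfl fun c _ ↦ Finset.sum_congr rfl fun d _ ↦ ?_
    rw [h3 c d a b]; ring
  · rw [swap fun a b c d ↦ A i a * A k b * A l c * A j d * R a b c d,
      swap fun a b c d ↦ A i a * A l b * A j c * A k d * R a b c d,
      swap fun a b c d ↦ A i a * A l c * A j d * A k b * R a c d b]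
    simp only [← Finset.sum_add_distrib]
    refine Finset.sum_eq_zero fun a _ ↦ Finset.sum_eq_zero fun b _ ↦
      Finset.sum_eq_zero fun c _ ↦ Finset.sum_eq_zero fun d _ ↦ ?_
    linear_combination A i a * A j b * A k c * A l d * h4 a b c d

/-- The action of a matrix on algebraic curvature tensors. -/
def rotate {n : ℕ} (A : Matrix (Fin n) (Fin n) ℝ) (R : algCurv n) : algCurv n :=
  ⟨rotateFun A R.1, rotateFun_mem A R.2⟩

/-- The Ricci tensor of an algebraic curvature tensor. -/
def ricci {n : ℕ} (R : algCurv n) : Matrix (Fin n) (Fin n) ℝ :=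
  Matrix.of fun i k ↦ ∑ j, R.1 i j k j

/-- The scalar curvature of an algebraic curvature tensor. -/
def scal {n : ℕ} (R : algCurv n) : ℝ := ∑ i, ricci R i i

/-- The curvature tensor `I_{ijkl} = δ_{ik} δ_{jl} - δ_{il} δ_{jk}` of the unit sphere. -/
def unitCurv (n : ℕ) : algCurv n :=
  ⟨fun i j k l ↦ (if i = k then 1 else 0) * (if j = l then 1 else 0)
      - (if i = l then 1 else 0) * (if j = k then 1 else 0), by
    refine ⟨fun i j k l ↦ by ring, fun i j k l ↦ by ring, fun i j k l ↦ ?_, fun i j k l ↦ ?_⟩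
    · simp only [eq_comm (a := k), eq_comm (a := l)]; ring
    · simp only [eq_comm (a := k), eq_comm (a := l) (b := j)]; ring⟩

/-- `C` is invariant under the Hamilton ODE: every solution of `dR/dt = Q(R)` which starts in `C`
stays in `C` for as long as it exists in forward time. -/
def IsHamiltonInvariant {n : ℕ} (C : Set (algCurv n)) : Prop :=
  ∀ (T : ℝ) (R : ℝ → algCurv n),
    (∀ t ∈ Set.Icc 0 T, HasDerivWithinAt R (hamiltonQ (R t)) (Set.Icc 0 T) t) →
    R 0 ∈ C → ∀ t ∈ Set.Icc 0 T, R t ∈ C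

/-! ### Riemannian geometry -/

section Geometry

open VectorField FiberBundle

variable {E : Type*} [NormedAddCommGroup E] [NormedSpace ℝ E]
  {M : Type*} [TopologicalSpace M] [ChartedSpace E M] [IsManifold 𝓘(ℝ, E) ∞ M]

/-- Smooth Riemannian metrics on a manifold without boundary modelled on `E`. -/
abbrev Metric (E : Type*) [NormedAddCommGroup E] [NormedSpace ℝ E]
    (M : Type*) [TopologicalSpace M] [ChartedSpace E M] [IsManifold 𝓘(ℝ, E) ∞ M] :=
  Bundle.ContMDiffRiemannianMetric 𝓘(ℝ, E) ∞ E (fun x : M ↦ TangentSpace 𝓘(ℝ, E) x)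

variable (g : Metric E M)

theorem mdifferentiableAt_inner {Y Z : Π x : M, TangentSpace 𝓘(ℝ, E) x} {x : M}
    (hY : MDiffAt (T% Y) x) (hZ : MDiffAt (T% Z) x) :
    MDiffAt (fun y ↦ g.inner y (Y y) (Z y)) x := by
  have h : MDifferentiableAt 𝓘(ℝ, E) (𝓘(ℝ, E).prod 𝓘(ℝ))
      (fun m ↦ Bundle.TotalSpace.mk' ℝ (E := Bundle.Trivial M ℝ) m (g.inner m (Y m) (Z m))) x := by
    apply MDifferentiableAt.clm_bundle_apply₂ (F₁ := E) (F₂ := E)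
    · exact g.contMDiff.mdifferentiableAt (by simp)
    · exact hY
    · exact hZ
  simp only [mdifferentiableAt_totalSpace] at h
  exact h.2

/-- The right-hand side of the Koszul formula for `g(∇_X Y, Z)`. -/
def koszul (X Y Z : Π x : M, TangentSpace 𝓘(ℝ, E) x) (x : M) : ℝ :=
  (1 / 2 : ℝ) *
    (d% (fun y ↦ g.inner y (Y y) (Z y)) x (X x)
      + d% (fun y ↦ g.inner y (X y) (Z y)) x (Y x)
      - d% (fun y ↦ g.inner y (X y) (Y y)) x (Z x)
      + g.inner x (mlieBracket 𝓘(ℝ, E) X Y x) (Z x)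
      - g.inner x (mlieBracket 𝓘(ℝ, E) X Z x) (Y x)
      - g.inner x (mlieBracket 𝓘(ℝ, E) Y Z x) (X x))

variable [FiniteDimensional ℝ E]

theorem koszul_tensorial_left {Y Z : Π x : M, TangentSpace 𝓘(ℝ, E) x} {x : M}
    (hY : MDiffAt (T% Y) x) (hZ : MDiffAt (T% Z) x) :
    TensorialAt 𝓘(ℝ, E) E (fun X ↦ koszul g X Y Z x) x where
  smul {f X} hf hX := by
    have e1 : (fun y ↦ g.inner y ((f • X) y) (Z y)) = f * fun y ↦ g.inner y (X y) (Z y) := by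
      ext y; simp
    have e2 : (fun y ↦ g.inner y ((f • X) y) (Y y)) = f * fun y ↦ g.inner y (X y) (Y y) := by
      ext y; simp
    simp only [koszul, e1, e2, mvfderiv_mul hf (mdifferentiableAt_inner g hX hZ),
      mvfderiv_mul hf (mdifferentiableAt_inner g hX hY), mlieBracket_smul_left hf hX]
    simp
    ring
  add {X X'} hX hX' := by
    have e1 : (fun y ↦ g.inner y ((X + X') y) (Z y)) =
        (fun y ↦ g.inner y (X y) (Z y)) + fun y ↦ g.inner y (X' y) (Z y) := by
      ext y; simp
    have e2 : (fun y ↦ g.inner y ((X + X') y) (Y y)) =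
        (fun y ↦ g.inner y (X y) (Y y)) + fun y ↦ g.inner y (X' y) (Y y) := by
      ext y; simp
    simp only [koszul, e1, e2, mlieBracket_add_left hX hX',
      mvfderiv_add (mdifferentiableAt_inner g hX hZ) (mdifferentiableAt_inner g hX' hZ),
      mvfderiv_add (mdifferentiableAt_inner g hX hY) (mdifferentiableAt_inner g hX' hY)]
    simp
    ring

theorem koszul_tensorial_right {X Y : Π x : M, TangentSpace 𝓘(ℝ, E) x} {x : M}
    (hX : MDiffAt (T% X) x) (hY : MDiffAt (T% Y) x) :
    TensorialAt 𝓘(ℝ, E) E (fun Z ↦ koszul g X Y Z x) x where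
  smul {f Z} hf hZ := by
    have e1 : (fun y ↦ g.inner y (X y) ((f • Z) y)) = f * fun y ↦ g.inner y (X y) (Z y) := by
      ext y; simp
    have e2 : (fun y ↦ g.inner y (Y y) ((f • Z) y)) = f * fun y ↦ g.inner y (Y y) (Z y) := by
      ext y; simp
    simp only [koszul, e1, e2, mvfderiv_mul hf (mdifferentiableAt_inner g hX hZ),
      mvfderiv_mul hf (mdifferentiableAt_inner g hY hZ), mlieBracket_smul_right hf hZ]
    simp [g.symm x (Z x) (X x), g.symm x (Z x) (Y x)]
    ring
  add {Z Z'} hZ hZ' := by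
    have e1 : (fun y ↦ g.inner y (X y) ((Z + Z') y)) =
        (fun y ↦ g.inner y (X y) (Z y)) + fun y ↦ g.inner y (X y) (Z' y) := by
      ext y; simp
    have e2 : (fun y ↦ g.inner y (Y y) ((Z + Z') y)) =
        (fun y ↦ g.inner y (Y y) (Z y)) + fun y ↦ g.inner y (Y y) (Z' y) := by
      ext y; simp
    simp only [koszul, e1, e2, mlieBracket_add_right hZ hZ',
      mvfderiv_add (mdifferentiableAt_inner g hX hZ) (mdifferentiableAt_inner g hX hZ'),
      mvfderiv_add (mdifferentiableAt_inner g hY hZ) (mdifferentiableAt_inner g hY hZ')]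
    simp
    ring

theorem koszul_add_mid {X Y Y' Z : Π x : M, TangentSpace 𝓘(ℝ, E) x} {x : M}
    (hX : MDiffAt (T% X) x) (hY : MDiffAt (T% Y) x) (hY' : MDiffAt (T% Y') x)
    (hZ : MDiffAt (T% Z) x) :
    koszul g X (Y + Y') Z x = koszul g X Y Z x + koszul g X Y' Z x := by
  have e1 : (fun y ↦ g.inner y ((Y + Y') y) (Z y)) =
      (fun y ↦ g.inner y (Y y) (Z y)) + fun y ↦ g.inner y (Y' y) (Z y) := by
    ext y; simp
  have e2 : (fun y ↦ g.inner y (X y) ((Y + Y') y)) =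
      (fun y ↦ g.inner y (X y) (Y y)) + fun y ↦ g.inner y (X y) (Y' y) := by
    ext y; simp
  simp only [koszul, e1, e2, mlieBracket_add_right hY hY', mlieBracket_add_left hY hY',
    mvfderiv_add (mdifferentiableAt_inner g hY hZ) (mdifferentiableAt_inner g hY' hZ),
    mvfderiv_add (mdifferentiableAt_inner g hX hY) (mdifferentiableAt_inner g hX hY')]
  simp
  ring

theorem koszul_smul_mid {X Y Z : Π x : M, TangentSpace 𝓘(ℝ, E) x} {f : M → ℝ} {x : M}
    (hf : MDiffAt f x) (hX : MDiffAt (T% X) x) (hY : MDiffAt (T% Y) x)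
    (hZ : MDiffAt (T% Z) x) :
    koszul g X (f • Y) Z x = f x * koszul g X Y Z x + d% f x (X x) * g.inner x (Y x) (Z x) := by
  have e1 : (fun y ↦ g.inner y ((f • Y) y) (Z y)) = f * fun y ↦ g.inner y (Y y) (Z y) := by
    ext y; simp
  have e2 : (fun y ↦ g.inner y (X y) ((f • Y) y)) = f * fun y ↦ g.inner y (X y) (Y y) := by
    ext y; simp
  simp only [koszul, e1, e2, mlieBracket_smul_right hf hY, mlieBracket_smul_left hf hY,
    mvfderiv_mul hf (mdifferentiableAt_inner g hY hZ),
    mvfderiv_mul hf (mdifferentiableAt_inner g hX hY)]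
  simp [g.symm x (Y x) (X x)]
  ring

/-- For a vector field `Y` that is differentiable at `x`, the bilinear form
`(X, Z) ↦ g(∇_X Y, Z)` on the tangent space at `x`. -/
def koszulForm (Y : Π x : M, TangentSpace 𝓘(ℝ, E) x) (x : M) (hY : MDiffAt (T% Y) x) :
    TangentSpace 𝓘(ℝ, E) x →L[ℝ] TangentSpace 𝓘(ℝ, E) x →L[ℝ] ℝ :=
  TensorialAt.mkHom₂ (fun X Z ↦ koszul g X Y Z x) x
    (fun _ hZ ↦ koszul_tensorial_left g hY hZ) (fun _ hX ↦ koszul_tensorial_right g hX hY)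

theorem koszulForm_apply {X Y Z : Π x : M, TangentSpace 𝓘(ℝ, E) x} {x : M}
    (hX : MDiffAt (T% X) x) (hY : MDiffAt (T% Y) x) (hZ : MDiffAt (T% Z) x) :
    koszulForm g Y x hY (X x) (Z x) = koszul g X Y Z x :=
  TensorialAt.mkHom₂_apply _ _ hX hZ

instance (x : M) : FiniteDimensional ℝ (TangentSpace 𝓘(ℝ, E) x) :=
  inferInstanceAs (FiniteDimensional ℝ E)

instance (x : M) : T2Space (TangentSpace 𝓘(ℝ, E) x) :=
  inferInstanceAs (T2Space E)

/-- The isomorphism `v ↦ g(v, ·)` from the tangent space at `x` onto its dual. -/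
def flat (x : M) : TangentSpace 𝓘(ℝ, E) x ≃ₗ[ℝ] Module.Dual ℝ (TangentSpace 𝓘(ℝ, E) x) :=
  LinearMap.linearEquivOfInjective
    { toFun := fun v ↦ (g.inner x v).toLinearMap
      map_add' := fun v w ↦ by ext; simp
      map_smul' := fun c v ↦ by ext; simp }
    (by
      rw [injective_iff_map_eq_zero]
      intro v hv
      by_contra hne
      exact (g.pos x v hne).ne' (LinearMap.congr_fun hv v))
    Subspace.dual_finrank_eq.symm

theorem inner_flat_symm (x : M) (φ : Module.Dual ℝ (TangentSpace 𝓘(ℝ, E) x))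
    (w : TangentSpace 𝓘(ℝ, E) x) : g.inner x ((flat g x).symm φ) w = φ w :=
  LinearMap.congr_fun ((flat g x).apply_symm_apply φ) w

theorem eq_of_inner_eq {x : M} {v v' : TangentSpace 𝓘(ℝ, E) x}
    (h : ∀ w, g.inner x v w = g.inner x v' w) : v = v' :=
  (flat g x).injective (LinearMap.ext h)

open Classical in
/-- `(∇_X Y)(x)`, as a function of `Y`, `x` and `X(x)`: the vector which represents the linear form
given by the Koszul formula. Only vector fields `Y` that are differentiable at `x` matter. -/
def leviCivitaFun (Y : Π x : M, TangentSpace 𝓘(ℝ, E) x) (x : M) :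
    TangentSpace 𝓘(ℝ, E) x →L[ℝ] TangentSpace 𝓘(ℝ, E) x :=
  if hY : MDiffAt (T% Y) x then
    LinearMap.toContinuousLinearMap
      { toFun := fun u ↦ (flat g x).symm (koszulForm g Y x hY u).toLinearMap
        map_add' := fun u v ↦ by rw [← map_add, map_add, ContinuousLinearMap.toLinearMap_add]
        map_smul' := fun c v ↦ by rw [RingHom.id_apply, ← map_smul, map_smul, ContinuousLinearMap.toLinearMap_smul] }
  else 0

theorem inner_leviCivitaFun {X Y Z : Π x : M, TangentSpace 𝓘(ℝ, E) x} {x : M}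
    (hX : MDiffAt (T% X) x) (hY : MDiffAt (T% Y) x) (hZ : MDiffAt (T% Z) x) :
    g.inner x (leviCivitaFun g Y x (X x)) (Z x) = koszul g X Y Z x := by
  rw [leviCivitaFun, dif_pos hY, ← koszulForm_apply g hX hY hZ]
  exact inner_flat_symm g x _ _

/-- The Levi-Civita connection of a Riemannian metric. -/
def leviCivita : CovariantDerivative 𝓘(ℝ, E) E (fun x : M ↦ TangentSpace 𝓘(ℝ, E) x) where
  toFun := leviCivitaFun g
  isCovariantDerivativeOnUniv :=
    { add := by
        intro Y Y' x hY hY' _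
        ext1 u
        refine eq_of_inner_eq g fun w ↦ ?_
        have hX := mdifferentiableAt_extend 𝓘(ℝ, E) E u
        have hZ := mdifferentiableAt_extend 𝓘(ℝ, E) E w
        have k := fun (Y : Π x : M, TangentSpace 𝓘(ℝ, E) x) (hY : MDiffAt (T% Y) x) ↦
          inner_leviCivitaFun g hX hY hZ
        simp only [extend_apply_self] at k
        rw [add_apply, map_add, add_apply, k Y hY,
          k Y' hY', k (Y + Y') (mdifferentiableAt_add_section hY hY'),
          koszul_add_mid g hX hY hY' hZ]
      leibniz := by
        intro Y f x hY hf _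
        ext1 u
        refine eq_of_inner_eq g fun w ↦ ?_
        have hX := mdifferentiableAt_extend 𝓘(ℝ, E) E u
        have hZ := mdifferentiableAt_extend 𝓘(ℝ, E) E w
        have k := fun (Y : Π x : M, TangentSpace 𝓘(ℝ, E) x) (hY : MDiffAt (T% Y) x) ↦
          inner_leviCivitaFun g hX hY hZ
        simp only [extend_apply_self] at k
        rw [k (f • Y) (hf.smul_section hY), koszul_smul_mid g hf hX hY hZ]
        simp [k Y hY] }

/-- `R(X, Y)Z = ∇_X ∇_Y Z - ∇_Y ∇_X Z - ∇_{[X, Y]} Z` for vector fields `X`, `Y`, `Z`. -/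
def curvatureField (X Y Z : Π x : M, TangentSpace 𝓘(ℝ, E) x) (x : M) : TangentSpace 𝓘(ℝ, E) x :=
  leviCivita g (fun y ↦ leviCivita g Z y (Y y)) x (X x)
    - leviCivita g (fun y ↦ leviCivita g Z y (X y)) x (Y x)
    - leviCivita g Z x (mlieBracket 𝓘(ℝ, E) X Y x)

/-- The Riemann curvature tensor `R(u, v, w, z) = g(R(u, v)z, w)` at `x`, computed with vector
fields that extend `u`, `v`, `z` smoothly near `x`. The sign is such that `R(u, v, u, v)` is the
sectional curvature of the plane spanned by orthonormal vectors `u`, `v`. -/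
def riemann (x : M) (u v w z : TangentSpace 𝓘(ℝ, E) x) : ℝ :=
  g.inner x (curvatureField g (extend E u) (extend E v) (extend E z) x) w

/-- `e` is an orthonormal frame of the tangent space at `x` (a basis when `E` has dimension `n`). -/
def IsOrthonormalFrame {n : ℕ} (x : M) (e : Fin n → TangentSpace 𝓘(ℝ, E) x) : Prop :=
  ∀ i j, g.inner x (e i) (e j) = if i = j then 1 else 0

/-- The components of the curvature tensor at `x` with respect to a frame `e`. -/
def curvatureComponents {n : ℕ} (x : M) (e : Fin n → TangentSpace 𝓘(ℝ, E) x) :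
    Fin n → Fin n → Fin n → Fin n → ℝ :=
  fun i j k l ↦ riemann g x (e i) (e j) (e k) (e l)

/-- The sectional curvature of the plane spanned by `u` and `v`. -/
def sectionalCurvature (x : M) (u v : TangentSpace 𝓘(ℝ, E) x) : ℝ :=
  riemann g x u v u v / (g.inner x u u * g.inner x v v - g.inner x u v ^ 2)

/-- All planes in all tangent spaces have the same sectional curvature. -/
def HasConstantSectionalCurvature : Prop :=
  ∃ κ : ℝ, ∀ (x : M) (u v : TangentSpace 𝓘(ℝ, E) x), LinearIndependent ℝ ![u, v] →
    sectionalCurvature g x u v = κ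

end Geometry

section Einstein

/-- `Ric = ρ g` for some real constant `ρ`, where `Ric(u, v) = ∑ i, R(u, e i, v, e i)` for
orthonormal bases `e` of the tangent space. -/
def IsEinstein {n : ℕ} {M : Type*} [TopologicalSpace M] [ChartedSpace (EuclideanSpace ℝ (Fin n)) M]
    [IsManifold (𝓡 n) ∞ M] (g : Metric (EuclideanSpace ℝ (Fin n)) M) : Prop :=
  ∃ ρ : ℝ, ∀ (x : M) (e : Fin n → TangentSpace (𝓡 n) x), IsOrthonormalFrame g x e →
    ∀ u v : TangentSpace (𝓡 n) x, ∑ i, riemann g x u (e i) v (e i) = ρ * g.inner x u v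

end Einstein

end EinsteinCone

end

open scoped Manifold ContDiff Topology Bundle

noncomputable section

set_option linter.unusedSectionVars false

namespace EinsteinCone

/-! Let `I` be the curvature tensor of the unit sphere, and let `κ` be the largest number such that
`S = R - κ I` lies in `C` at every point. Compactness and the interior hypothesis give `κ > 0`.
Nonnegative scalar curvature on `C` bounds the admissible `κ` by `ρ / (n - 1)`, because `Ric(S) = (ρ
- (n - 1) κ) g`. If equality holds, then `S` is Ricci flat everywhere, and a nonzero element of `C`
has nonzero Ricci tensor, so `S = 0` and `R = κ I`.

It remains to prove `ρ ≤ (n - 1) κ`. If this failed, `S` would be interior to `C` at every point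
(`le_of_shiftedCurv_notMem_interior`), and `κ` could be increased (`exists_shiftedCurv_mem`). At a
point where `S` lies on the boundary of `C`, take a linear functional `f ≥ 0` on `C` with `f(S) = 0`
and `f(I) > 0`. Three facts are combined: (a) invariance under the Hamilton ODE gives `f(Q(S)) ≥ 0`
(`hamiltonQ_nonneg`); (b) an Einstein metric satisfies `ΔR = 2ρ R - Q(R)` (`sum_nabla₂_curv`), and
the second derivative test gives `f(ΔR) ≥ 0` (`nonneg_laplacian`); (c) `Q(R - κ I) = Q(R) - 4κρ I +
2(n - 1)κ² I` for Einstein `R` (`hamiltonFun_sub_unitCurv`). Since `f(R) = κ f(I)`, adding (a) and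
(b) yields `0 ≤ 2κ f(I) ((n - 1)κ - ρ)`.

The formula for `ΔR` is proved by pure algebra, in a commutative algebra with derivations and skew
connection coefficients, and then evaluated in the algebra of smooth functions on the domain of an
orthonormal frame. The algebraic symmetries of `R`, including the first Bianchi identity, come from
the assumption that its components form an element of `C`; the second Bianchi identity is derived
from them. In (b), tensors at different points are compared through rotations `exp(-tΓ)`, which the
`O(n)`-invariance of `C` permits, instead of parallel transport. -/

/-! ### Tensor calculus in an orthonormal frame -/

/-- The derivation action of a matrix on tensors with four indices. -/
def act {n : ℕ} {A : Type*} [CommRing A] (X : Fin n → Fin n → A)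
    (T : Fin n → Fin n → Fin n → Fin n → A) : Fin n → Fin n → Fin n → Fin n → A :=
  fun i j k l ↦ ∑ a, (X i a * T a j k l + X j a * T i a k l + X k a * T i j a l + X l a * T i j k a)

/-- The algebraic data of a torsion-free metric connection in an orthonormal frame: `D i` is the
derivative in the direction of the `i`-th frame vector, `Γ i j k` are the connection coefficients
`⟨∇_{e_i} e_j, e_k⟩`. -/
structure FrameConnection (n : ℕ) (A : Type*) [CommRing A] [Algebra ℝ A] where
  D : Fin n → Derivation ℝ A A
  Γ : Fin n → Fin n → Fin n → A
  skew : ∀ i j k, Γ i j k = -Γ i k j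
  comm : ∀ i j f, D i (D j f) - D j (D i f) = ∑ k, (Γ i j k - Γ j i k) * D k f

namespace FrameConnection

variable {n : ℕ} {A : Type*} [CommRing A] [Algebra ℝ A] (K : FrameConnection n A)

/-- The structure coefficients of the frame. -/
def bracket (i j a : Fin n) : A := K.Γ i j a - K.Γ j i a

/-- The curvature components `⟨R(e_i, e_j) e_l, e_k⟩`. -/
def curv (i j k l : Fin n) : A :=
  K.D i (K.Γ j l k) - K.D j (K.Γ i l k)
    + ∑ a, (K.Γ j l a * K.Γ i a k - K.Γ i l a * K.Γ j a k) - ∑ a, K.bracket i j a * K.Γ a l k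

/-- The covariant derivative of a one-form. -/
def nablaVec (m : Fin n) (v : Fin n → A) (l : Fin n) : A := K.D m (v l) - ∑ a, K.Γ m l a * v a

/-- The derivative of a tensor with four indices in a frame direction, with these four indices
treated covariantly. -/
def nabla (m : Fin n) (T : Fin n → Fin n → Fin n → Fin n → A) (i j k l : Fin n) : A :=
  K.D m (T i j k l) - act (K.Γ m) T i j k l

/-- Terms with one derivative of `v` are symmetric in `i` and `j` and cancel; the second derivatives
combine through `comm`, and the rest assembles into `curv`. The bracket term is present because the
frame index is not treated covariantly. -/
theorem nablaVec_comm (i j : Fin n) (v : Fin n → A) (l : Fin n) :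
    K.nablaVec i (K.nablaVec j v) l - K.nablaVec j (K.nablaVec i v) l =
      ∑ a, K.bracket i j a * K.nablaVec a v l - ∑ k, K.curv i j k l * v k := by
  have h1 : ∀ i j, K.nablaVec i (K.nablaVec j v) l = K.D i (K.D j (v l))
      - ∑ a, (K.D i (K.Γ j l a) * v a + K.Γ j l a * K.D i (v a) + K.Γ i l a * K.D j (v a))
      + ∑ a, ∑ b, K.Γ i l b * K.Γ j b a * v a := fun i j ↦ by
    rw [Finset.sum_comm]
    simp only [nablaVec, map_sub, map_sum, Derivation.leibniz, smul_eq_mul, mul_sub,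
      Finset.sum_sub_distrib, Finset.mul_sum, Finset.sum_add_distrib, mul_assoc]
    simp only [mul_comm (v _) (K.D _ _)]
    ring
  have h2 : ∑ a, K.bracket i j a * K.nablaVec a v l = ∑ a, K.bracket i j a * K.D a (v l)
      - ∑ a, ∑ b, K.bracket i j b * K.Γ b l a * v a := by
    rw [Finset.sum_comm]
    simp only [nablaVec, mul_sub, Finset.sum_sub_distrib, Finset.mul_sum, mul_assoc]
  have h3 : ∑ k, K.curv i j k l * v k = ∑ k, (K.D i (K.Γ j l k) - K.D j (K.Γ i l k)) * v k
      + ∑ a, ∑ b, (K.Γ j l b * K.Γ i b a * v a - K.Γ i l b * K.Γ j b a * v a)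
      - ∑ a, ∑ b, K.bracket i j b * K.Γ b l a * v a := by
    simp only [curv, sub_mul, add_mul, Finset.sum_sub_distrib, Finset.sum_add_distrib,
      Finset.sum_mul]
  rw [h1, h1, h2, h3]
  have h4 := K.comm i j (v l)
  simp only [bracket, sub_mul, Finset.sum_sub_distrib, Finset.sum_add_distrib] at h4 ⊢
  linear_combination h4

theorem nablaVec_sub (m : Fin n) (v w : Fin n → A) :
    K.nablaVec m (v - w) = K.nablaVec m v - K.nablaVec m w := by
  ext l
  simp only [nablaVec, Pi.sub_apply, map_sub, mul_sub, Finset.sum_sub_distrib]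
  ring

/-- For a torsion-free connection, the cyclic sum of the curvature is the Jacobi identity of the
frame vectors. Jacobi is not part of `FrameConnection`, so it is recovered here from the first
Bianchi identity. -/
theorem jacobi_of_cyclic
    (h : ∀ i j k l, K.curv i j k l + K.curv j l k i + K.curv l i k j = 0) (i j l k : Fin n) :
    (K.D i (K.bracket j l k) + ∑ a, K.bracket j l a * K.bracket i a k)
      + (K.D j (K.bracket l i k) + ∑ a, K.bracket l i a * K.bracket j a k)
      + (K.D l (K.bracket i j k) + ∑ a, K.bracket i j a * K.bracket l a k) = 0 := by
  have e := h i j k l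
  have hs : ∀ i j l, ∑ a, (K.Γ j l a * K.Γ i a k - K.Γ i l a * K.Γ j a k)
      = ∑ a, K.Γ j l a * K.Γ i a k - ∑ a, K.Γ i l a * K.Γ j a k := fun i j l ↦
    Finset.sum_sub_distrib ..
  have hb : ∀ i j l, ∑ a, K.bracket i j a * K.Γ a l k =
      ∑ a, K.bracket i j a * K.Γ l a k - ∑ a, K.bracket i j a * K.bracket l a k := fun i j l ↦ by
    rw [← Finset.sum_sub_distrib]
    exact Finset.sum_congr rfl fun a _ ↦ by simp only [bracket]; ring
  have hc : ∀ i j l, ∑ a, K.bracket i j a * K.Γ l a k =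
      ∑ a, K.Γ i j a * K.Γ l a k - ∑ a, K.Γ j i a * K.Γ l a k := fun i j l ↦ by
    rw [← Finset.sum_sub_distrib]
    exact Finset.sum_congr rfl fun a _ ↦ by simp only [bracket]; ring
  have hd : ∀ i j l, K.D l (K.bracket i j k) = K.D l (K.Γ i j k) - K.D l (K.Γ j i k) :=
    fun i j l ↦ by simp only [bracket, map_sub]
  simp only [curv, hs, hb, hc] at e
  simp only [hd]
  linear_combination e

/-- The second Bianchi identity for the components in the first two slots. -/
theorem nablaVec_curv_cyclic
    (h : ∀ i j k l, K.curv i j k l + K.curv j l k i + K.curv l i k j = 0) (m i j k l : Fin n) :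
    (K.D m (K.curv i j k l) - ∑ a, K.Γ m l a * K.curv i j k a - ∑ a, K.Γ m k a * K.curv i j a l
        + ∑ a, K.bracket i j a * K.curv m a k l)
      + (K.D i (K.curv j m k l) - ∑ a, K.Γ i l a * K.curv j m k a
        - ∑ a, K.Γ i k a * K.curv j m a l + ∑ a, K.bracket j m a * K.curv i a k l)
      + (K.D j (K.curv m i k l) - ∑ a, K.Γ j l a * K.curv m i k a
        - ∑ a, K.Γ j k a * K.curv m i a l + ∑ a, K.bracket m i a * K.curv j a k l) = 0 := by
  -- A one-form with constant coefficients: its frame derivatives vanish, and contracting with it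
  -- selects the `k`-th component.
  set v : Fin n → A := Pi.single k 1 with hv
  set N := K.nablaVec with hN
  let P : Fin n → Fin n → (Fin n → A) → Fin n → A := fun i j w l ↦
    ∑ a, K.bracket i j a * N a w l - ∑ b, K.curv i j b l * w b
  have hP : ∀ i j w, N i (N j w) - N j (N i w) = P i j w := fun i j w ↦ by
    ext l; exact K.nablaVec_comm i j w l
  -- `P i j` is the commutator of `N i` and `N j`, so this is the Jacobi identity for commutators of
  -- operators. Each summand splits into a Jacobi expression of the frame, which cancels in the
  -- cyclic sum, and a derivative of the curvature.
  have hjac : (N m (P i j v) - P i j (N m v)) + (N i (P j m v) - P j m (N i v))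
      + (N j (P m i v) - P m i (N j v)) = 0 := by
    simp only [← hP, hN, nablaVec_sub]
    abel
  have hsum : ∀ m i j, (N m (P i j v) - P i j (N m v)) l =
      ∑ b, (K.D m (K.bracket i j b) + ∑ a, K.bracket i j a * K.bracket m a b) * N b v l
      - (K.D m (K.curv i j k l) - ∑ a, K.Γ m l a * K.curv i j k a
        - ∑ a, K.Γ m k a * K.curv i j a l + ∑ a, K.bracket i j a * K.curv m a k l) := by
    intro m i j
    have h1 : ∀ a b, K.curv a b k l = ∑ c, K.curv a b c l * v c := fun a b ↦ by
      simp [hv, Pi.single_apply]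
    have h2 : N m (P i j v) l = ∑ a, (K.D m (K.bracket i j a) * N a v l
        + K.bracket i j a * N m (N a v) l) - K.D m (K.curv i j k l)
          + ∑ a, K.Γ m l a * K.curv i j k a := by
      have : ∀ c, P i j v c = ∑ a, K.bracket i j a * N a v c - K.curv i j k c := fun c ↦ by
        simp [P, hv, Pi.single_apply]
      have hu : ∀ w : Fin n → A, N m w l = K.D m (w l) - ∑ a, K.Γ m l a * w a := fun _ ↦ rfl
      rw [hu (P i j v)]
      simp only [hu (N _ v), this, map_sub, map_sum, Derivation.leibniz, smul_eq_mul, mul_sub,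
        Finset.sum_sub_distrib, Finset.mul_sum, Finset.sum_add_distrib]
      rw [Finset.sum_comm]
      simp only [mul_left_comm (K.bracket _ _ _) (K.Γ _ _ _), mul_comm (K.D m (K.bracket _ _ _))]
      ring
    have h3 : P i j (N m v) l = ∑ a, K.bracket i j a * N a (N m v) l
        + ∑ a, K.Γ m a k * K.curv i j a l := by
      have : ∀ b, N m v b = - K.Γ m b k := fun b ↦ by
        rw [hN, nablaVec]
        have : K.D m (v b) = 0 := by
          rw [hv, Pi.single_apply]
          split_ifs <;> simp
        rw [this]
        simp [hv, Pi.single_apply]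
      simp only [P, this, Finset.sum_neg_distrib, mul_comm (K.curv _ _ _ _), neg_mul]
      ring
    have h4 : ∑ a, K.bracket i j a * N m (N a v) l - ∑ a, K.bracket i j a * N a (N m v) l
        = ∑ b, (∑ a, K.bracket i j a * K.bracket m a b) * N b v l
          - ∑ a, K.bracket i j a * K.curv m a k l := by
      simp only [Finset.sum_mul]
      rw [Finset.sum_comm, ← Finset.sum_sub_distrib, ← Finset.sum_sub_distrib]
      refine Finset.sum_congr rfl fun a _ ↦ ?_
      rw [← mul_sub, h1 m a]
      have := congrFun (hP m a v) l
      rw [Pi.sub_apply] at this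
      rw [this]
      simp only [P, mul_sub, Finset.mul_sum, mul_assoc]
    have h5 : ∑ a, K.Γ m a k * K.curv i j a l = - ∑ a, K.Γ m k a * K.curv i j a l := by
      rw [← Finset.sum_neg_distrib]
      exact Finset.sum_congr rfl fun a _ ↦ by rw [K.skew m a k]; ring
    rw [Pi.sub_apply, h2, h3, h5]
    simp only [add_mul, Finset.sum_add_distrib]
    linear_combination h4
  have hz : ∑ b, (K.D m (K.bracket i j b) + ∑ a, K.bracket i j a * K.bracket m a b) * N b v l
      + ∑ b, (K.D i (K.bracket j m b) + ∑ a, K.bracket j m a * K.bracket i a b) * N b v l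
      + ∑ b, (K.D j (K.bracket m i b) + ∑ a, K.bracket m i a * K.bracket j a b) * N b v l = 0 := by
    rw [← Finset.sum_add_distrib, ← Finset.sum_add_distrib]
    refine Finset.sum_eq_zero fun b _ ↦ ?_
    rw [← add_mul, ← add_mul, K.jacobi_of_cyclic h m i j b, zero_mul]
  have := congrFun hjac l
  simp only [Pi.add_apply, hsum, Pi.zero_apply] at this
  linear_combination hz - this

end FrameConnection

/-! ### The Lie algebra action of matrices on four-tensors -/

section Act

variable {n : ℕ} {A : Type*} [CommRing A]

theorem act_sub_left (X Y : Fin n → Fin n → A) (T : Fin n → Fin n → Fin n → Fin n → A) :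
    act (X - Y) T = act X T - act Y T := by
  ext i j k l
  simp only [act, Pi.sub_apply, ← Finset.sum_sub_distrib]
  exact Finset.sum_congr rfl fun a _ ↦ by ring

theorem act_neg_left (X : Fin n → Fin n → A) (T : Fin n → Fin n → Fin n → Fin n → A) :
    act (-X) T = -act X T := by
  ext i j k l
  simp only [act, Pi.neg_apply, ← Finset.sum_neg_distrib]
  exact Finset.sum_congr rfl fun a _ ↦ by ring

theorem act_add_right (X : Fin n → Fin n → A) (S T : Fin n → Fin n → Fin n → Fin n → A) :
    act X (S + T) = act X S + act X T := by
  ext i j k l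
  simp only [act, Pi.add_apply, ← Finset.sum_add_distrib]
  exact Finset.sum_congr rfl fun a _ ↦ by ring

theorem act_sub_right (X : Fin n → Fin n → A) (S T : Fin n → Fin n → Fin n → Fin n → A) :
    act X (S - T) = act X S - act X T := by
  ext i j k l
  simp only [act, Pi.sub_apply, ← Finset.sum_sub_distrib]
  exact Finset.sum_congr rfl fun a _ ↦ by ring

theorem act_sum_left {ι : Type*} (s : Finset ι) (c : ι → A) (X : ι → Fin n → Fin n → A)
    (T : Fin n → Fin n → Fin n → Fin n → A) (i j k l : Fin n) :
    act (fun i j ↦ ∑ b ∈ s, c b * X b i j) T i j k l = ∑ b ∈ s, c b * act (X b) T i j k l := by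
  simp only [act, Finset.mul_sum]
  rw [Finset.sum_comm]
  refine Finset.sum_congr rfl fun a _ ↦ ?_
  simp only [Finset.sum_mul, ← Finset.sum_add_distrib]
  exact Finset.sum_congr rfl fun b _ ↦ by ring

/-- When `X` and `Y` act on different slots they commute, so only the terms with both in the same
slot survive, and these form the matrix commutator. -/
theorem act_act_sub (X Y : Fin n → Fin n → A) (T : Fin n → Fin n → Fin n → Fin n → A) :
    act X (act Y T) - act Y (act X T) =
      act (fun i j ↦ ∑ a, (X i a * Y a j - Y i a * X a j)) T := by
  ext i j k l
  have expand : ∀ X Y : Fin n → Fin n → A, act X (act Y T) i j k l =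
      ∑ a, ∑ b, (X i a * Y a b * T b j k l + X j a * Y a b * T i b k l
        + X k a * Y a b * T i j b l + X l a * Y a b * T i j k b
        + (X i a * Y j b + X j b * Y i a) * T a b k l + (X i a * Y k b + X k b * Y i a) * T a j b l
        + (X i a * Y l b + X l b * Y i a) * T a j k b + (X j a * Y k b + X k b * Y j a) * T i a b l
        + (X j a * Y l b + X l b * Y j a) * T i a k b
        + (X k a * Y l b + X l b * Y k a) * T i j a b) := fun X Y ↦ by
    calc act X (act Y T) i j k l
        = ∑ a, ∑ b, (X i a * Y a b * T b j k l + X j a * Y a b * T i b k l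
          + X k a * Y a b * T i j b l + X l a * Y a b * T i j k b
          + X i a * Y j b * T a b k l + X i a * Y k b * T a j b l
          + X i a * Y l b * T a j k b + X j a * Y k b * T i a b l
          + X j a * Y l b * T i a k b + X k a * Y l b * T i j a b)
          + ∑ a, ∑ b, (X j a * Y i b * T b a k l + X k a * Y i b * T b j a l
          + X l a * Y i b * T b j k a + X k a * Y j b * T i b a l
          + X l a * Y j b * T i b k a + X l a * Y k b * T i j b a) := by
          simp only [act, Finset.mul_sum, ← Finset.sum_add_distrib]
          exact Finset.sum_congr rfl fun a _ ↦ Finset.sum_congr rfl fun b _ ↦ by ring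
      _ = _ := by
          -- Renaming the summation indices makes the mixed terms visibly symmetric under exchange
          -- of `X` and `Y`.
          rw [Finset.sum_comm (f := fun a b ↦ (X j a * Y i b * T b a k l + X k a * Y i b * T b j a l
          + X l a * Y i b * T b j k a + X k a * Y j b * T i b a l
          + X l a * Y j b * T i b k a + X l a * Y k b * T i j b a))]
          simp only [← Finset.sum_add_distrib]
          exact Finset.sum_congr rfl fun a _ ↦ Finset.sum_congr rfl fun b _ ↦ by ring
  rw [Pi.sub_apply, Pi.sub_apply, Pi.sub_apply, Pi.sub_apply, expand, expand]
  simp only [act, Finset.sum_mul, ← Finset.sum_add_distrib]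
  conv_rhs => rw [Finset.sum_comm]
  simp only [← Finset.sum_sub_distrib]
  exact Finset.sum_congr rfl fun a _ ↦ Finset.sum_congr rfl fun b _ ↦ by ring

theorem derivation_act [Algebra ℝ A] (D : Derivation ℝ A A) (X : Fin n → Fin n → A)
    (T : Fin n → Fin n → Fin n → Fin n → A) (i j k l : Fin n) :
    D (act X T i j k l) = act (fun i j ↦ D (X i j)) T i j k l
      + act X (fun i j k l ↦ D (T i j k l)) i j k l := by
  simp only [act, map_sum, map_add, Derivation.leibniz, smul_eq_mul, ← Finset.sum_add_distrib]
  exact Finset.sum_congr rfl fun a _ ↦ by ring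

end Act

/-! ### The Ricci identity and second covariant derivatives -/

namespace FrameConnection

variable {n : ℕ} {A : Type*} [CommRing A] [Algebra ℝ A] (K : FrameConnection n A)

/-- The Ricci identity, before the correction by the bracket of the frame vectors. -/
theorem nabla_comm (i j : Fin n) (T : Fin n → Fin n → Fin n → Fin n → A) (a b c d : Fin n) :
    K.nabla i (K.nabla j T) a b c d - K.nabla j (K.nabla i T) a b c d =
      ∑ m, K.bracket i j m * K.nabla m T a b c d
        - act (fun l k ↦ K.curv i j k l) T a b c d := by
  have h1 : ∀ i j, K.nabla i (K.nabla j T) a b c d = K.D i (K.D j (T a b c d))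
      - act (fun p q ↦ K.D i (K.Γ j p q)) T a b c d
      - act (K.Γ j) (fun a b c d ↦ K.D i (T a b c d)) a b c d
      - act (K.Γ i) (fun a b c d ↦ K.D j (T a b c d)) a b c d
      + act (K.Γ i) (act (K.Γ j) T) a b c d := fun i j ↦ by
    have : K.nabla j T = (fun a b c d ↦ K.D j (T a b c d)) - act (K.Γ j) T := rfl
    rw [nabla, this, act_sub_right]
    simp only [Pi.sub_apply, map_sub, derivation_act]
    ring
  have h2 : (fun l k ↦ K.curv i j k l) = (fun p q ↦ K.D i (K.Γ j p q))
      - (fun p q ↦ K.D j (K.Γ i p q))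
      - (fun p q ↦ ∑ m, (K.Γ i p m * K.Γ j m q - K.Γ j p m * K.Γ i m q))
      - (fun p q ↦ ∑ m, K.bracket i j m * K.Γ m p q) := by
    ext l k
    simp only [curv, Pi.sub_apply, Finset.sum_sub_distrib]
    ring
  rw [h1, h1, h2, act_sub_left, act_sub_left, act_sub_left, ← act_act_sub]
  simp only [Pi.sub_apply, act_sum_left]
  have h3 : ∑ m, K.bracket i j m * K.nabla m T a b c d =
      (K.D i (K.D j (T a b c d)) - K.D j (K.D i (T a b c d)))
      - ∑ m, K.bracket i j m * act (K.Γ m) T a b c d := by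
    rw [K.comm]
    simp only [nabla, mul_sub, Finset.sum_sub_distrib]
    rfl
  rw [h3]
  ring

/-- The second covariant derivative of a tensor with four indices. -/
def nabla₂ (p q : Fin n) (T : Fin n → Fin n → Fin n → Fin n → A) (i j k l : Fin n) : A :=
  K.nabla p (K.nabla q T) i j k l - ∑ a, K.Γ p q a * K.nabla a T i j k l

/-- The corrections `Γ p q a - Γ q p a` in `nabla₂` are the structure coefficients (no torsion), so
they absorb the bracket term of `nabla_comm`. -/
theorem nabla₂_comm (p q : Fin n) (T : Fin n → Fin n → Fin n → Fin n → A) (i j k l : Fin n) :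
    K.nabla₂ p q T i j k l = K.nabla₂ q p T i j k l
      - act (fun l k ↦ K.curv p q k l) T i j k l := by
  have := K.nabla_comm p q T i j k l
  simp only [bracket, sub_mul, Finset.sum_sub_distrib] at this
  simp only [nabla₂]
  linear_combination this

/-- The curvature of the connection has the symmetries of an algebraic curvature tensor, and its
Ricci tensor is a parallel multiple of the metric. -/
structure IsEinsteinCurv (r : A) : Prop where
  skew_left : ∀ i j k l, K.curv i j k l = -K.curv j i k l
  skew_right : ∀ i j k l, K.curv i j k l = -K.curv i j l k
  pair : ∀ i j k l, K.curv i j k l = K.curv k l i j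
  bianchi : ∀ i j k l, K.curv i j k l + K.curv i k l j + K.curv i l j k = 0
  const : ∀ m, K.D m r = 0
  ricci : ∀ i k, ∑ j, K.curv i j k j = if i = k then r else 0

variable {K} {r : A} (hK : K.IsEinsteinCurv r)

/-! ### Differential identities for the curvature of an Einstein metric -/

namespace IsEinsteinCurv

/-- `act` treats all four slots alike, so covariant differentiation preserves the slot symmetries of
the curvature. -/
theorem nabla_skew_left (hK : K.IsEinsteinCurv r) (m i j k l : Fin n) :
    K.nabla m K.curv i j k l = -K.nabla m K.curv j i k l := by
  have h := hK.skew_left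
  have hs : act (K.Γ m) K.curv i j k l = -act (K.Γ m) K.curv j i k l := by
    simp only [act, ← Finset.sum_neg_distrib]
    refine Finset.sum_congr rfl fun a _ ↦ ?_
    rw [h i j a l, h i j k a, h i a k l, h a j k l]
    ring
  rw [nabla, nabla, hs, h i j k l, map_neg]
  ring

theorem nabla_pair (hK : K.IsEinsteinCurv r) (m i j k l : Fin n) :
    K.nabla m K.curv i j k l = K.nabla m K.curv k l i j := by
  have h := hK.pair
  have hs : act (K.Γ m) K.curv i j k l = act (K.Γ m) K.curv k l i j := by
    simp only [act]
    refine Finset.sum_congr rfl fun a _ ↦ ?_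
    rw [h i j a l, h i j k a, h i a k l, h a j k l]
    ring
  rw [nabla, nabla, hs, h i j k l]

theorem nabla_skew_right (hK : K.IsEinsteinCurv r) (m i j k l : Fin n) :
    K.nabla m K.curv i j k l = -K.nabla m K.curv i j l k := by
  rw [hK.nabla_pair, hK.nabla_skew_left, hK.nabla_pair]

/-- The second Bianchi identity. -/
theorem nabla_cyclic (hK : K.IsEinsteinCurv r) (m i j k l : Fin n) :
    K.nabla m K.curv i j k l + K.nabla i K.curv j m k l + K.nabla j K.curv m i k l = 0 := by
  have hc : ∀ i j k l, K.curv i j k l + K.curv j l k i + K.curv l i k j = 0 := fun i j k l ↦ by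
    have := hK.bianchi k l i j
    rw [hK.pair k l, hK.pair k i, hK.pair k j] at this
    exact this
  have h := K.nablaVec_curv_cyclic hc m i j k l
  have key : ∀ a, (K.Γ m i a * K.curv a j k l + K.Γ m j a * K.curv i a k l)
      + (K.Γ i j a * K.curv a m k l + K.Γ i m a * K.curv j a k l)
      + (K.Γ j m a * K.curv a i k l + K.Γ j i a * K.curv m a k l)
      + K.bracket i j a * K.curv m a k l + K.bracket j m a * K.curv i a k l
      + K.bracket m i a * K.curv j a k l = 0 := fun a ↦ by
    rw [hK.skew_left a j, hK.skew_left a m, hK.skew_left a i]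
    simp only [bracket]
    ring
  have key' := Finset.sum_eq_zero fun a (_ : a ∈ Finset.univ) ↦ key a
  simp only [nabla, act, Finset.sum_add_distrib] at key' ⊢
  linear_combination h - key'

/-- Skewness of `Γ` makes contraction commute with `nabla`, and a constant multiple of the metric is
parallel. -/
theorem sum_nabla_ricci (hK : K.IsEinsteinCurv r) (m i j : Fin n) :
    ∑ k, K.nabla m K.curv i k j k = 0 := by
  have h1 : ∑ k, K.D m (K.curv i k j k) = 0 := by
    rw [← map_sum, hK.ricci]
    split_ifs <;> simp [hK.const]
  have h2 : ∑ k, ∑ a, K.Γ m k a * K.curv i a j k = -∑ k, ∑ a, K.Γ m k a * K.curv i k j a := by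
    rw [Finset.sum_comm, ← Finset.sum_neg_distrib]
    refine Finset.sum_congr rfl fun k _ ↦ ?_
    rw [← Finset.sum_neg_distrib]
    refine Finset.sum_congr rfl fun a _ ↦ ?_
    rw [K.skew]
    ring
  have h3 : ∀ i j, ∑ k, ∑ a, K.Γ m i a * K.curv a k j k = K.Γ m i j * r := fun i j ↦ by
    rw [Finset.sum_comm]
    simp only [← Finset.mul_sum, hK.ricci]
    simp
  have h4 : ∀ i j, ∑ k, ∑ a, K.Γ m j a * K.curv i k a k = K.Γ m j i * r := fun i j ↦ by
    rw [← h3]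
    exact Finset.sum_congr rfl fun k _ ↦ Finset.sum_congr rfl fun a _ ↦ by rw [hK.pair]
  simp only [nabla, act, Finset.sum_sub_distrib, Finset.sum_add_distrib, h1, h2, h3, h4]
  rw [K.skew m i j]
  ring

/-- In the contracted second Bianchi identity the other two terms are derivatives of the Ricci
tensor. -/
theorem sum_nabla_divergence (hK : K.IsEinsteinCurv r) (i j l : Fin n) :
    ∑ m, K.nabla m K.curv i j m l = 0 := by
  have h := Finset.sum_eq_zero fun m (_ : m ∈ Finset.univ) ↦ hK.nabla_cyclic m i j m l
  have h1 : ∀ m, K.nabla i K.curv j m m l = -K.nabla i K.curv j m l m := fun m ↦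
    hK.nabla_skew_right ..
  have h2 : ∀ m, K.nabla j K.curv m i m l = K.nabla j K.curv i m l m := fun m ↦ by
    rw [hK.nabla_skew_right, hK.nabla_skew_left, neg_neg]
  simp only [Finset.sum_add_distrib, h1, h2, Finset.sum_neg_distrib, hK.sum_nabla_ricci] at h
  linear_combination h

theorem nabla₂_pair (hK : K.IsEinsteinCurv r) (p q i j k l : Fin n) :
    K.nabla₂ p q K.curv i j k l = K.nabla₂ p q K.curv k l i j := by
  have hs : act (K.Γ p) (K.nabla q K.curv) i j k l = act (K.Γ p) (K.nabla q K.curv) k l i j := by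
    simp only [act]
    refine Finset.sum_congr rfl fun a _ ↦ ?_
    have h := hK.nabla_pair q
    rw [h i j a l, h i j k a, h i a k l, h a j k l]
    ring
  simp only [nabla₂, nabla.eq_def K p (K.nabla q K.curv), hs, hK.nabla_pair _ i j k l]

theorem nabla₂_skew_left (hK : K.IsEinsteinCurv r) (p q i j k l : Fin n) :
    K.nabla₂ p q K.curv i j k l = -K.nabla₂ p q K.curv j i k l := by
  have hs : act (K.Γ p) (K.nabla q K.curv) i j k l =
      -act (K.Γ p) (K.nabla q K.curv) j i k l := by
    simp only [act, ← Finset.sum_neg_distrib]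
    refine Finset.sum_congr rfl fun a _ ↦ ?_
    have h := hK.nabla_skew_left q
    rw [h i j a l, h i j k a, h i a k l, h a j k l]
    ring
  simp only [nabla₂, nabla.eq_def K p (K.nabla q K.curv), hs, hK.nabla_skew_left _ i j k l,
    mul_neg, Finset.sum_neg_distrib, map_neg]
  ring

/-- The second Bianchi identity, differentiated once more. Each `Γ`-correction is itself that
identity with one index replaced, including the derivative index `m`; this is what `key` records. -/
theorem nabla₂_cyclic (hK : K.IsEinsteinCurv r) (p m i j k l : Fin n) :
    K.nabla₂ p m K.curv i j k l + K.nabla₂ p i K.curv j m k l + K.nabla₂ p j K.curv m i k l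
      = 0 := by
  have h := hK.nabla_cyclic
  have h0 := congrArg (K.D p) (h m i j k l)
  have key : ∀ a, K.Γ p i a * K.nabla m K.curv a j k l + K.Γ p j a * K.nabla m K.curv i a k l
      + K.Γ p k a * K.nabla m K.curv i j a l + K.Γ p l a * K.nabla m K.curv i j k a
      + K.Γ p m a * K.nabla a K.curv i j k l
      + (K.Γ p j a * K.nabla i K.curv a m k l + K.Γ p m a * K.nabla i K.curv j a k l
      + K.Γ p k a * K.nabla i K.curv j m a l + K.Γ p l a * K.nabla i K.curv j m k a
      + K.Γ p i a * K.nabla a K.curv j m k l)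
      + (K.Γ p m a * K.nabla j K.curv a i k l + K.Γ p i a * K.nabla j K.curv m a k l
      + K.Γ p k a * K.nabla j K.curv m i a l + K.Γ p l a * K.nabla j K.curv m i k a
      + K.Γ p j a * K.nabla a K.curv m i k l) = 0 := fun a ↦ by
    linear_combination K.Γ p i a * h m a j k l + K.Γ p j a * h m i a k l + K.Γ p k a * h m i j a l
      + K.Γ p l a * h m i j k a + K.Γ p m a * h a i j k l
  have key' := Finset.sum_eq_zero fun a (_ : a ∈ Finset.univ) ↦ key a
  simp only [map_add, map_zero] at h0
  simp only [nabla₂]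
  simp only [nabla.eq_def K p, act, Finset.sum_add_distrib] at key' ⊢
  linear_combination h0 - key'

/-- Here the contracted pair includes the derivative index; its two connection terms cancel because
`Γ` is skew. -/
theorem sum_nabla₂_divergence (hK : K.IsEinsteinCurv r) (p i j l : Fin n) :
    ∑ m, K.nabla₂ p m K.curv i j m l = 0 := by
  have h := hK.sum_nabla_divergence
  have h0 := congrArg (K.D p) (h i j l)
  have h1 : ∑ m, ∑ a, K.Γ p m a * K.nabla m K.curv i j a l =
      -∑ m, ∑ a, K.Γ p m a * K.nabla a K.curv i j m l := by
    rw [Finset.sum_comm, ← Finset.sum_neg_distrib]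
    refine Finset.sum_congr rfl fun k _ ↦ ?_
    rw [← Finset.sum_neg_distrib]
    refine Finset.sum_congr rfl fun a _ ↦ ?_
    rw [K.skew]
    ring
  have h2 : ∀ i' j' l' : Fin n → Fin n, ∀ c : Fin n → A,
      ∑ m, ∑ a, c a * K.nabla m K.curv (i' a) (j' a) m (l' a) = 0 := fun i' j' l' c ↦ by
    rw [Finset.sum_comm]
    simp only [← Finset.mul_sum, h, mul_zero, Finset.sum_const_zero]
  simp only [nabla₂, nabla.eq_def K p, act, Finset.sum_sub_distrib, Finset.sum_add_distrib, h1]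
  rw [← map_sum, h0, map_zero, h2 (fun a ↦ a) (fun _ ↦ j) (fun _ ↦ l),
    h2 (fun _ ↦ i) (fun a ↦ a) (fun _ ↦ l), h2 (fun _ ↦ i) (fun _ ↦ j) (fun a ↦ a)]
  ring

/-- The Laplacian of the curvature tensor of an Einstein metric. -/
theorem sum_nabla₂_curv (hK : K.IsEinsteinCurv r) (i j k l : Fin n) :
    ∑ m, K.nabla₂ m m K.curv i j k l = 2 * r * K.curv i j k l
      - (∑ p, ∑ q, K.curv i j p q * K.curv k l p q
        + 2 * ∑ p, ∑ q, (K.curv i p k q * K.curv j p l q - K.curv i p l q * K.curv j p k q)) := by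
  have hdiv : ∀ p i j l, ∑ m, K.nabla₂ p m K.curv i m j l = 0 := fun p i j l ↦ by
    rw [← neg_zero, ← hK.sum_nabla₂_divergence p j l i, ← Finset.sum_neg_distrib]
    exact Finset.sum_congr rfl fun m _ ↦ by rw [hK.nabla₂_skew_left, hK.nabla₂_pair]
  -- The second Bianchi identity moves one derivative onto `i` or `j`. Exchanging the two
  -- derivatives produces divergences, which vanish, at the price of quadratic curvature terms.
  have h1 : ∑ m, K.nabla₂ m m K.curv i j k l =
      ∑ m, act (fun l k ↦ K.curv m i k l) K.curv j m k l
      - ∑ m, act (fun l k ↦ K.curv m j k l) K.curv i m k l := by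
    have e : ∀ m, K.nabla₂ m m K.curv i j k l = act (fun l k ↦ K.curv m i k l) K.curv j m k l
        - act (fun l k ↦ K.curv m j k l) K.curv i m k l
        - K.nabla₂ i m K.curv j m k l + K.nabla₂ j m K.curv i m k l := fun m ↦ by
      have h := hK.nabla₂_cyclic m m i j k l
      rw [hK.nabla₂_skew_left m j m i, K.nabla₂_comm m i, K.nabla₂_comm m j] at h
      linear_combination h
    simp only [e, Finset.sum_sub_distrib, Finset.sum_add_distrib, hdiv]
    ring
  -- Of the four slots, the one carrying the summed index `m` contracts to the Ricci tensor and
  -- gives the linear term.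
  have h2 : ∀ i j, ∑ m, act (fun l k ↦ K.curv m i k l) K.curv j m k l =
      - r * K.curv j i k l + ∑ m, ∑ a, (K.curv m i a j * K.curv a m k l
        + K.curv m i a k * K.curv j m a l + K.curv m i a l * K.curv j m k a) := fun i j ↦ by
    have e : ∑ m, ∑ a, K.curv m i a m * K.curv j a k l = - r * K.curv j i k l := by
      rw [Finset.sum_comm]
      have : ∀ a, ∑ m, K.curv m i a m = if i = a then -r else 0 := fun a ↦ by
        have := hK.ricci i a
        rw [Finset.sum_congr rfl fun m _ ↦ hK.skew_left m i a m, Finset.sum_neg_distrib, this]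
        split_ifs <;> simp
      simp only [← Finset.sum_mul, this]
      simp
    rw [← e]
    simp only [act, ← Finset.sum_add_distrib]
    exact Finset.sum_congr rfl fun m _ ↦ Finset.sum_congr rfl fun a _ ↦ by ring
  -- The first Bianchi identity merges the two factors into `curv i j m a`, giving the first sum of
  -- `Q`.
  have h3 : ∑ m, ∑ a, (K.curv m i a j * K.curv a m k l - K.curv m j a i * K.curv a m k l) =
      - ∑ p, ∑ q, K.curv i j p q * K.curv k l p q := by
    simp only [← Finset.sum_neg_distrib]
    refine Finset.sum_congr rfl fun m _ ↦ Finset.sum_congr rfl fun a _ ↦ ?_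
    have e1 := hK.bianchi i j m a
    rw [hK.skew_left i m, hK.skew_right i a] at e1
    have e2 : K.curv m j a i = -K.curv i a m j := by rw [hK.pair, hK.skew_left]
    have e3 : K.curv a m k l = -K.curv k l m a := by rw [hK.skew_left, hK.pair]
    rw [e2, e3]
    linear_combination K.curv k l m a * e1
  have h4 : ∀ i j, ∑ m, ∑ a, (K.curv m i a k * K.curv j m a l + K.curv m i a l * K.curv j m k a) =
      -∑ p, ∑ q, (K.curv i p k q * K.curv j p l q - K.curv i p l q * K.curv j p k q) :=
    fun i j ↦ by
    simp only [← Finset.sum_neg_distrib]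
    refine Finset.sum_congr rfl fun m _ ↦ Finset.sum_congr rfl fun a _ ↦ ?_
    rw [hK.skew_left m i a k, hK.skew_right i m a k, hK.skew_left m i a l, hK.skew_right i m a l,
      hK.skew_right j m a l]
    ring
  have h5 : ∑ p, ∑ q, (K.curv j p k q * K.curv i p l q - K.curv j p l q * K.curv i p k q) =
      -∑ p, ∑ q, (K.curv i p k q * K.curv j p l q - K.curv i p l q * K.curv j p k q) := by
    simp only [← Finset.sum_neg_distrib]
    exact Finset.sum_congr rfl fun m _ ↦ Finset.sum_congr rfl fun a _ ↦ by ring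
  have h6 := h4 i j
  have h7 := h4 j i
  rw [h5] at h7
  rw [h1, h2, h2, hK.skew_left j i]
  simp only [Finset.sum_sub_distrib, Finset.sum_add_distrib] at h3 h6 h7 ⊢
  linear_combination h3 + h6 - h7

end IsEinsteinCurv

end FrameConnection

theorem two_le_infty : (2 : ℕ∞ω) ≤ ∞ :=
  WithTop.coe_le_coe.2 (le_top : (2 : ℕ∞) ≤ ⊤)

theorem three_le_infty : (3 : ℕ∞ω) ≤ ∞ :=
  WithTop.coe_le_coe.2 (le_top : (3 : ℕ∞) ≤ ⊤)

section LocalGeometry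

open VectorField FiberBundle

variable {E : Type*} [NormedAddCommGroup E] [NormedSpace ℝ E]
  {M : Type*} [TopologicalSpace M] [ChartedSpace E M] [IsManifold 𝓘(ℝ, E) ∞ M]

/-! ### Smooth functions and vector fields on an open set -/

/-- A real function which is smooth at every point of `U`. -/
def SmoothFunOn (E : Type*) [NormedAddCommGroup E] [NormedSpace ℝ E]
    {M : Type*} [TopologicalSpace M] [ChartedSpace E M] (U : Set M) (f : M → ℝ) : Prop :=
  ∀ y ∈ U, ContMDiffAt 𝓘(ℝ, E) 𝓘(ℝ) ∞ f y

/-- A vector field which is smooth at every point of `U`. -/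
def SmoothFieldOn (U : Set M) (X : Π x : M, TangentSpace 𝓘(ℝ, E) x) : Prop :=
  ∀ y ∈ U, CMDiffAt ∞ (T% X) y

variable {U : Set M} {f h : M → ℝ} {X Y Z : Π x : M, TangentSpace 𝓘(ℝ, E) x} {y : M}

theorem SmoothFunOn.mdiffAt (hf : SmoothFunOn E U f) (hy : y ∈ U) : MDiffAt f y :=
  (hf y hy).mdifferentiableAt (by simp)

theorem SmoothFieldOn.mdiffAt (hX : SmoothFieldOn U X) (hy : y ∈ U) : MDiffAt (T% X) y :=
  (hX y hy).mdifferentiableAt (by simp)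

theorem SmoothFunOn.const (c : ℝ) : SmoothFunOn E U fun _ ↦ c := fun _ _ ↦ contMDiffAt_const

theorem SmoothFunOn.add (hf : SmoothFunOn E U f) (hh : SmoothFunOn E U h) :
    SmoothFunOn E U (f + h) := fun y hy ↦ (hf y hy).add (hh y hy)

theorem SmoothFunOn.sub (hf : SmoothFunOn E U f) (hh : SmoothFunOn E U h) :
    SmoothFunOn E U (f - h) := fun y hy ↦ (hf y hy).sub (hh y hy)

theorem SmoothFunOn.mul (hf : SmoothFunOn E U f) (hh : SmoothFunOn E U h) :
    SmoothFunOn E U (f * h) := fun y hy ↦ (hf y hy).mul (hh y hy)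

theorem SmoothFunOn.congr (hf : SmoothFunOn E U f) (hU : IsOpen U) (hfh : ∀ y ∈ U, h y = f y) :
    SmoothFunOn E U h := fun y hy ↦ (hf y hy).congr_of_eventuallyEq <|
  Filter.eventuallyEq_of_mem (hU.mem_nhds hy) hfh

theorem SmoothFieldOn.add (hX : SmoothFieldOn U X) (hY : SmoothFieldOn U Y) :
    SmoothFieldOn U (X + Y) := fun y hy ↦ (hX y hy).add_section (hY y hy)

theorem SmoothFieldOn.sub (hX : SmoothFieldOn U X) (hY : SmoothFieldOn U Y) :
    SmoothFieldOn U (X - Y) := fun y hy ↦ (hX y hy).sub_section (hY y hy)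

theorem SmoothFieldOn.smul (hf : SmoothFunOn E U f) (hX : SmoothFieldOn U X) :
    SmoothFieldOn U (f • X) := fun y hy ↦ (hf y hy).smul_section (hX y hy)

theorem SmoothFieldOn.sum {ι : Type*} {s : Finset ι} {X : ι → Π x : M, TangentSpace 𝓘(ℝ, E) x}
    (hX : ∀ i ∈ s, SmoothFieldOn U (X i)) : SmoothFieldOn U (fun x ↦ ∑ i ∈ s, X i x) :=
  fun y hy ↦ ContMDiffAt.sum_section fun i hi ↦ hX i hi y hy

theorem SmoothFieldOn.congr (hX : SmoothFieldOn U X) (hU : IsOpen U)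
    (hXY : ∀ y ∈ U, Y y = X y) : SmoothFieldOn U Y := fun y hy ↦ by
  refine (hX y hy).congr_of_eventuallyEq ?_
  filter_upwards [hU.mem_nhds hy] with z hz
  rw [hXY z hz]

theorem SmoothFieldOn.zero : SmoothFieldOn U (0 : Π x : M, TangentSpace 𝓘(ℝ, E) x) :=
  fun _ _ ↦ Bundle.contMDiff_zeroSection _ _ |>.contMDiffAt

theorem SmoothFieldOn.inner (g : Metric E M) (hX : SmoothFieldOn U X) (hY : SmoothFieldOn U Y) :
    SmoothFunOn E U fun y ↦ g.inner y (X y) (Y y) := fun y hy ↦ by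
  have h : ContMDiffAt 𝓘(ℝ, E) (𝓘(ℝ, E).prod 𝓘(ℝ)) ∞
      (fun m ↦ Bundle.TotalSpace.mk' ℝ (E := Bundle.Trivial M ℝ) m (g.inner m (X m) (Y m))) y := by
    apply ContMDiffAt.clm_bundle_apply₂ (F₁ := E) (F₂ := E)
    · exact g.contMDiff.contMDiffAt
    · exact hX y hy
    · exact hY y hy
  rw [Bundle.contMDiffAt_totalSpace] at h
  exact h.2

variable [CompleteSpace E]

theorem SmoothFieldOn.mlieBracket (hX : SmoothFieldOn U X) (hY : SmoothFieldOn U Y) :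
    SmoothFieldOn U (mlieBracket 𝓘(ℝ, E) X Y) := fun y hy ↦ by
  have : IsManifold 𝓘(ℝ, E) (((⊤ : ℕ∞) : ℕ∞ω) + 1) M := ‹IsManifold 𝓘(ℝ, E) ∞ M›
  have : IsManifold 𝓘(ℝ, E) (minSmoothness ℝ 2) M := by
    rw [minSmoothness_of_isRCLikeNormedField]
    exact .of_le (n := ∞) two_le_infty
  exact ContMDiffAt.mlieBracket_vectorField (m := ⊤) (n := ⊤) (hX y hy) (hY y hy) (by simp)

theorem mlieBracket_mlieBracket (hX : SmoothFieldOn U X) (hY : SmoothFieldOn U Y)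
    (hZ : SmoothFieldOn U Z) (hy : y ∈ U) :
    mlieBracket 𝓘(ℝ, E) X (mlieBracket 𝓘(ℝ, E) Y Z) y =
      mlieBracket 𝓘(ℝ, E) (mlieBracket 𝓘(ℝ, E) X Y) Z y
        + mlieBracket 𝓘(ℝ, E) Y (mlieBracket 𝓘(ℝ, E) X Z) y := by
  have : IsManifold 𝓘(ℝ, E) (minSmoothness ℝ 3) M := by
    rw [minSmoothness_of_isRCLikeNormedField]
    exact .of_le (n := ∞) three_le_infty
  have h2 : (2 : ℕ∞ω) ≤ ∞ := two_le_infty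
  refine leibniz_identity_mlieBracket_apply ?_ ?_ ?_ <;>
    rw [minSmoothness_of_isRCLikeNormedField]
  exacts [(hX y hy).of_le h2, (hY y hy).of_le h2,
    (hZ y hy).of_le h2]

/-- The derivative of a smooth function along a smooth vector field is smooth, in the presence of
a unit vector field. -/
theorem SmoothFunOn.mvfderiv_of_unit (g : Metric E M) (hU : IsOpen U) (hf : SmoothFunOn E U f)
    (hX : SmoothFieldOn U X) (hZ : SmoothFieldOn U Z) (hZ1 : ∀ y ∈ U, g.inner y (Z y) (Z y) = 1) :
    SmoothFunOn E U fun y ↦ d% f y (X y) := by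
  -- For a unit field `Z`, `X(f) = ⟨[X, fZ], Z⟩ - f ⟨[X, Z], Z⟩`, and brackets of smooth fields are
  -- smooth.
  refine ((((hX.mlieBracket (hZ.smul hf)).inner g hZ)).sub
    (hf.mul ((hX.mlieBracket hZ).inner g hZ))).congr hU fun y hy ↦ ?_
  simp [mlieBracket_smul_right (hf.mdiffAt hy) (hZ.mdiffAt hy), hZ1 y hy]

/-- The Lie bracket acts on functions as the commutator. -/
theorem mvfderiv_mlieBracket (g : Metric E M) (hU : IsOpen U) (hf : SmoothFunOn E U f)
    (hX : SmoothFieldOn U X) (hY : SmoothFieldOn U Y) (hZ : SmoothFieldOn U Z)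
    (hZ1 : ∀ y ∈ U, g.inner y (Z y) (Z y) = 1) (hy : y ∈ U) :
    d% f y (VectorField.mlieBracket 𝓘(ℝ, E) X Y y) =
      d% (fun y ↦ d% f y (Y y)) y (X y) - d% (fun y ↦ d% f y (X y)) y (Y y) := by
  have hd : ∀ {X}, SmoothFieldOn U X → SmoothFunOn E U fun y ↦ d% f y (X y) := fun hX ↦
    hf.mvfderiv_of_unit g hU hX hZ hZ1
  have key : ∀ {X Y : Π x : M, TangentSpace 𝓘(ℝ, E) x}, SmoothFieldOn U X → SmoothFieldOn U Y →
      VectorField.mlieBracket 𝓘(ℝ, E) X (VectorField.mlieBracket 𝓘(ℝ, E) Y (f • Z)) y =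
        d% (fun y ↦ d% f y (Y y)) y (X y) • Z y
        + d% f y (Y y) • VectorField.mlieBracket 𝓘(ℝ, E) X Z y
        + (d% f y (X y) • VectorField.mlieBracket 𝓘(ℝ, E) Y Z y
        + f y • VectorField.mlieBracket 𝓘(ℝ, E) X (VectorField.mlieBracket 𝓘(ℝ, E) Y Z) y) := by
    intro X Y hX hY
    have hev : VectorField.mlieBracket 𝓘(ℝ, E) Y (f • Z) =ᶠ[𝓝 y]
        (fun y ↦ d% f y (Y y)) • Z + f • VectorField.mlieBracket 𝓘(ℝ, E) Y Z := by
      filter_upwards [hU.mem_nhds hy] with z hz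
      exact mlieBracket_smul_right (hf.mdiffAt hz) (hZ.mdiffAt hz)
    rw [Filter.EventuallyEq.mlieBracket_vectorField_eq (Filter.EventuallyEq.refl _ X) hev,
      mlieBracket_add_right ((hZ.smul (hd hY)).mdiffAt hy)
        (((hY.mlieBracket hZ).smul hf).mdiffAt hy),
      mlieBracket_smul_right ((hd hY).mdiffAt hy) (hZ.mdiffAt hy),
      mlieBracket_smul_right (hf.mdiffAt hy) ((hY.mlieBracket hZ).mdiffAt hy)]
  -- The Jacobi identity for `X`, `Y`, `fZ`: after removal of that for `X`, `Y`, `Z`, the inner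
  -- product with the unit field `Z` isolates the derivatives of `f`.
  have hJ := mlieBracket_mlieBracket hX hY (hZ.smul hf) hy
  rw [key hX hY, key hY hX, mlieBracket_smul_right (hf.mdiffAt hy) (hZ.mdiffAt hy),
    mlieBracket_mlieBracket hX hY hZ hy] at hJ
  have hJ' := congrArg (fun v ↦ g.inner y v (Z y)) hJ
  simp only [map_add, map_smul, add_apply, smul_apply, smul_eq_mul,
    hZ1 y hy] at hJ'
  linear_combination -hJ'

end LocalGeometry

section Frames

open VectorField FiberBundle

variable {E : Type*} [NormedAddCommGroup E] [NormedSpace ℝ E]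
  {M : Type*} [TopologicalSpace M] [ChartedSpace E M] [IsManifold 𝓘(ℝ, E) ∞ M]
  [FiniteDimensional ℝ E] {g : Metric E M}

/-! ### Orthonormal frames -/

theorem IsOrthonormalFrame.linearIndependent {n : ℕ} {x : M}
    {e : Fin n → TangentSpace 𝓘(ℝ, E) x} (he : IsOrthonormalFrame g x e) :
    LinearIndependent ℝ e := by
  rw [Fintype.linearIndependent_iff]
  intro c hc i
  have := congrArg (fun v ↦ g.inner x v (e i)) hc
  simpa [he _ _] using this

theorem IsOrthonormalFrame.sum_inner_smul {n : ℕ} (hn : Module.finrank ℝ E = n) {x : M}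
    {e : Fin n → TangentSpace 𝓘(ℝ, E) x} (he : IsOrthonormalFrame g x e)
    (v : TangentSpace 𝓘(ℝ, E) x) : ∑ i, g.inner x v (e i) • e i = v := by
  have hli := he.linearIndependent
  have hfr : Fintype.card (Fin n) = Module.finrank ℝ (TangentSpace 𝓘(ℝ, E) x) := by
    rw [Fintype.card_fin]; exact hn.symm
  have hspan : v ∈ Submodule.span ℝ (Set.range e) := by
    rw [hli.span_eq_top_of_card_eq_finrank' hfr]; trivial
  obtain ⟨c, rfl⟩ := (Submodule.mem_span_range_iff_exists_fun ℝ).1 hspan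
  refine Finset.sum_congr rfl fun i _ ↦ ?_
  simp [he _ _]

/-- A smooth orthonormal frame of the tangent bundle on an open set. -/
structure IsOrthonormalFrameOn (g : Metric E M) {n : ℕ} (U : Set M)
    (e : Fin n → Π x : M, TangentSpace 𝓘(ℝ, E) x) : Prop where
  isOpen : IsOpen U
  smooth : ∀ i, SmoothFieldOn U (e i)
  orthonormal : ∀ y ∈ U, IsOrthonormalFrame g y fun i ↦ e i y
  finrank : Module.finrank ℝ E = n

theorem IsOrthonormalFrameOn.mono {n : ℕ} {U V : Set M}
    {e : Fin n → Π x : M, TangentSpace 𝓘(ℝ, E) x} (he : IsOrthonormalFrameOn g U e)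
    (hV : IsOpen V) (hVU : V ⊆ U) : IsOrthonormalFrameOn g V e where
  isOpen := hV
  smooth i y hy := he.smooth i y (hVU hy)
  orthonormal y hy := he.orthonormal y (hVU hy)
  finrank := he.finrank

/-! ### The Levi-Civita connection in a frame -/

variable {U : Set M} {f : M → ℝ} {X X' Y Z W : Π x : M, TangentSpace 𝓘(ℝ, E) x} {y : M} {n : ℕ}
  {e : Fin n → Π x : M, TangentSpace 𝓘(ℝ, E) x}

theorem inner_leviCivita (hX : SmoothFieldOn U X) (hY : SmoothFieldOn U Y)
    (hZ : SmoothFieldOn U Z) (hy : y ∈ U) :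
    g.inner y (leviCivita g Y y (X y)) (Z y) = koszul g X Y Z y :=
  inner_leviCivitaFun g (hX.mdiffAt hy) (hY.mdiffAt hy) (hZ.mdiffAt hy)

theorem leviCivita_add (hY : SmoothFieldOn U Y) (hZ : SmoothFieldOn U Z) (hy : y ∈ U) :
    leviCivita g (Y + Z) y = leviCivita g Y y + leviCivita g Z y :=
  (leviCivita g).isCovariantDerivativeOnUniv.add (hY.mdiffAt hy) (hZ.mdiffAt hy)

theorem leviCivita_smul (hf : SmoothFunOn E U f) (hY : SmoothFieldOn U Y) (hy : y ∈ U)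
    (v : TangentSpace 𝓘(ℝ, E) y) :
    leviCivita g (f • Y) y v = f y • leviCivita g Y y v + d% f y v • Y y := by
  have := (leviCivita g).isCovariantDerivativeOnUniv.leibniz (hY.mdiffAt hy) (hf.mdiffAt hy)
  exact congrArg (fun L ↦ L v) this

theorem leviCivita_congr (hU : IsOpen U) (hY : SmoothFieldOn U Y) (hYZ : ∀ y ∈ U, Z y = Y y)
    (hy : y ∈ U) : leviCivita g Z y = leviCivita g Y y :=
  (leviCivita g).isCovariantDerivativeOnUniv.congr_of_eventuallyEq
    ((hY.congr hU hYZ).mdiffAt hy) (hY.mdiffAt hy) Filter.univ_mem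
    (Filter.eventually_of_mem (hU.mem_nhds hy) hYZ)

theorem leviCivita_sum {ι : Type*} {s : Finset ι} {Y : ι → Π x : M, TangentSpace 𝓘(ℝ, E) x}
    (hY : ∀ i ∈ s, SmoothFieldOn U (Y i)) (hy : y ∈ U) :
    leviCivita g (fun x ↦ ∑ i ∈ s, Y i x) y = ∑ i ∈ s, leviCivita g (Y i) y := by
  classical
  induction s using Finset.induction_on with
  | empty =>
    simp only [Finset.sum_empty]
    exact congrFun (leviCivita g).zero y
  | insert a s ha ih =>
    simp only [Finset.mem_insert, forall_eq_or_imp] at hY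
    simp only [Finset.sum_insert ha, ← ih hY.2]
    exact leviCivita_add hY.1 (.sum hY.2) hy

/-- The index `i` only supplies a unit field, as `mvfderiv_of_unit` requires. -/
theorem koszul_smooth (he : IsOrthonormalFrameOn g U e) (i : Fin n) (hX : SmoothFieldOn U X)
    (hY : SmoothFieldOn U Y) (hZ : SmoothFieldOn U Z) : SmoothFunOn E U (koszul g X Y Z) := by
  have hd : ∀ {f X}, SmoothFunOn E U f → SmoothFieldOn U X →
      SmoothFunOn E U fun y ↦ d% f y (X y) := fun hf hX ↦
    hf.mvfderiv_of_unit g he.isOpen hX (he.smooth i) fun y hy ↦ by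
      rw [he.orthonormal y hy i i, if_pos rfl]
  exact (SmoothFunOn.const (1 / 2)).mul <|
    (((((hd (hY.inner g hZ) hX).add (hd (hX.inner g hZ) hY)).sub (hd (hX.inner g hY) hZ)).add
      ((hX.mlieBracket hY).inner g hZ)).sub ((hX.mlieBracket hZ).inner g hY)).sub
      ((hY.mlieBracket hZ).inner g hX)

theorem leviCivita_eq_sum (he : IsOrthonormalFrameOn g U e) (hX : SmoothFieldOn U X)
    (hY : SmoothFieldOn U Y) (hy : y ∈ U) :
    leviCivita g Y y (X y) = ∑ k, koszul g X Y (e k) y • e k y := by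
  rw [← (he.orthonormal y hy).sum_inner_smul he.finrank (leviCivita g Y y (X y))]
  exact Finset.sum_congr rfl fun k _ ↦ by rw [inner_leviCivita hX hY (he.smooth k) hy]

theorem SmoothFieldOn.leviCivita (he : IsOrthonormalFrameOn g U e) (hX : SmoothFieldOn U X)
    (hY : SmoothFieldOn U Y) : SmoothFieldOn U fun y ↦ leviCivita g Y y (X y) :=
  (SmoothFieldOn.sum (s := Finset.univ)
    fun i _ ↦ (he.smooth i).smul (koszul_smooth he i hX hY (he.smooth i))).congr he.isOpen
      fun _ hy ↦ leviCivita_eq_sum he hX hY hy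

/-! ### Tensoriality of the curvature -/

theorem curvatureField_swap : curvatureField g X Y Z y = -curvatureField g Y X Z y := by
  rw [curvatureField, curvatureField, mlieBracket_swap_apply, map_neg]
  abel

theorem curvatureField_add_left (he : IsOrthonormalFrameOn g U e) (hX : SmoothFieldOn U X)
    (hX' : SmoothFieldOn U X') (hZ : SmoothFieldOn U Z) (hy : y ∈ U) :
    curvatureField g (X + X') Y Z y = curvatureField g X Y Z y + curvatureField g X' Y Z y := by
  have h1 : (fun y ↦ leviCivita g Z y ((X + X') y)) =
      (fun y ↦ leviCivita g Z y (X y)) + fun y ↦ leviCivita g Z y (X' y) := by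
    ext y; simp
  rw [curvatureField, h1]
  simp only [curvatureField, mlieBracket_add_left (hX.mdiffAt hy) (hX'.mdiffAt hy), map_add,
    Pi.add_apply, leviCivita_add (hX.leviCivita he hZ) (hX'.leviCivita he hZ) hy, add_apply]
  abel

/-- The derivative of `f` along `Y` in the second term cancels against the one in `[fX, Y] = f [X,
Y] - Y(f) X`. -/
theorem curvatureField_smul_left (he : IsOrthonormalFrameOn g U e) (hf : SmoothFunOn E U f)
    (hX : SmoothFieldOn U X) (hZ : SmoothFieldOn U Z) (hy : y ∈ U) :
    curvatureField g (f • X) Y Z y = f y • curvatureField g X Y Z y := by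
  have h1 : (fun y ↦ leviCivita g Z y ((f • X) y)) =
      f • fun y ↦ leviCivita g Z y (X y) := by
    ext y; simp
  rw [curvatureField, h1]
  simp only [curvatureField, mlieBracket_smul_left (hf.mdiffAt hy) (hX.mdiffAt hy), map_add,
    Pi.smul_apply', leviCivita_smul hf (hX.leviCivita he hZ) hy, map_smul]
  module

theorem curvatureField_add_right (he : IsOrthonormalFrameOn g U e) (hX : SmoothFieldOn U X)
    (hY : SmoothFieldOn U Y) (hZ : SmoothFieldOn U Z) (hW : SmoothFieldOn U W) (hy : y ∈ U) :
    curvatureField g X Y (Z + W) y = curvatureField g X Y Z y + curvatureField g X Y W y := by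
  have h1 : ∀ {X Y}, SmoothFieldOn U X → SmoothFieldOn U Y →
      leviCivita g (fun y ↦ leviCivita g (Z + W) y (X y)) y (Y y) =
      leviCivita g (fun y ↦ leviCivita g Z y (X y)) y (Y y) +
      leviCivita g (fun y ↦ leviCivita g W y (X y)) y (Y y) := fun {X Y} hX hY ↦ by
    rw [leviCivita_congr he.isOpen ((hX.leviCivita he hZ).add (hX.leviCivita he hW))
      (fun y hy ↦ by simp [leviCivita_add hZ hW hy]) hy,
      leviCivita_add (hX.leviCivita he hZ) (hX.leviCivita he hW) hy, add_apply]
  simp only [curvatureField, h1 hX hY, h1 hY hX, leviCivita_add hZ hW hy, add_apply]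
  abel

/-- The second derivatives of `f` leave `X(Yf) - Y(Xf)`, which the term `[X, Y] f` cancels.
Nonemptiness provides the unit field for that identity. -/
theorem curvatureField_smul_right [Nonempty (Fin n)] (he : IsOrthonormalFrameOn g U e)
    (hf : SmoothFunOn E U f)
    (hX : SmoothFieldOn U X) (hY : SmoothFieldOn U Y) (hZ : SmoothFieldOn U Z) (hy : y ∈ U) :
    curvatureField g X Y (f • Z) y = f y • curvatureField g X Y Z y := by
  obtain ⟨i⟩ := ‹Nonempty (Fin n)›
  have hu : ∀ y ∈ U, g.inner y (e i y) (e i y) = 1 := fun y hy ↦ by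
    rw [he.orthonormal y hy i i, if_pos rfl]
  have hd : ∀ {X}, SmoothFieldOn U X → SmoothFunOn E U fun y ↦ d% f y (X y) := fun hX ↦
    hf.mvfderiv_of_unit g he.isOpen hX (he.smooth i) hu
  have h1 : ∀ {X Y}, SmoothFieldOn U X → SmoothFieldOn U Y →
      leviCivita g (fun y ↦ leviCivita g (f • Z) y (X y)) y (Y y) =
      (f y • leviCivita g (fun y ↦ leviCivita g Z y (X y)) y (Y y)
        + d% f y (Y y) • leviCivita g Z y (X y))
      + (d% f y (X y) • leviCivita g Z y (Y y)
        + d% (fun y ↦ d% f y (X y)) y (Y y) • Z y) := fun {X Y} hX hY ↦ by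
    rw [leviCivita_congr he.isOpen (((hX.leviCivita he hZ).smul hf).add (hZ.smul (hd hX)))
      (fun y hy ↦ by simp [leviCivita_smul hf hZ hy]) hy,
      leviCivita_add ((hX.leviCivita he hZ).smul hf) (hZ.smul (hd hX)) hy, add_apply,
      leviCivita_smul hf (hX.leviCivita he hZ) hy, leviCivita_smul (hd hX) hZ hy]
  simp only [curvatureField, h1 hX hY, h1 hY hX, leviCivita_smul hf hZ hy,
    mvfderiv_mlieBracket g he.isOpen hf hX hY (he.smooth i) hu hy]
  module

/-- An operation on smooth vector fields which is linear over smooth functions is determined by its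
values on a frame. -/
theorem IsOrthonormalFrameOn.tensorial_eq_sum {A : Type*} [AddCommGroup A] [Module ℝ A]
    (he : IsOrthonormalFrameOn g U e) (hy : y ∈ U) {Φ : (Π x : M, TangentSpace 𝓘(ℝ, E) x) → A}
    (hadd : ∀ X X', SmoothFieldOn U X → SmoothFieldOn U X' → Φ (X + X') = Φ X + Φ X')
    (hsmul : ∀ f X, SmoothFunOn E U f → SmoothFieldOn U X → Φ (f • X) = f y • Φ X)
    (hX : SmoothFieldOn U X) : Φ X = ∑ i, g.inner y (X y) (e i y) • Φ (e i) := by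
  classical
  have hzero : Φ 0 = 0 := by
    have := hsmul (fun _ ↦ 0) 0 (.const 0) .zero
    simpa using this
  have hsum : ∀ s : Finset (Fin n),
      Φ (fun x ↦ ∑ i ∈ s, ((fun y ↦ g.inner y (X y) (e i y)) • e i) x) =
        ∑ i ∈ s, g.inner y (X y) (e i y) • Φ (e i) := fun s ↦ by
    induction s using Finset.induction_on with
    | empty =>
      simp only [Finset.sum_empty]
      exact hzero
    | insert a s ha ih =>
      have hs : ∀ i, SmoothFieldOn U ((fun y ↦ g.inner y (X y) (e i y)) • e i) := fun i ↦
        (he.smooth i).smul (hX.inner g (he.smooth i))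
      simp only [Finset.sum_insert ha, ← ih]
      rw [← hsmul _ _ (hX.inner g (he.smooth a)) (he.smooth a)]
      exact hadd _ _ (hs a) (.sum fun i _ ↦ hs i)
  rw [← hsum]
  -- `X` agrees with its frame expansion only on `U`, while `Φ` sees global fields and is not
  -- assumed to be local. Multiplication by the indicator, which is smooth at the points of `U`,
  -- makes the two fields equal.
  let ψ : M → ℝ := U.indicator 1
  have hψ : SmoothFunOn E U ψ := (SmoothFunOn.const 1).congr he.isOpen fun y hy ↦ by
    simp [ψ, hy]
  have hψy : ψ y = 1 := by simp [ψ, hy]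
  have key : ψ • X = ψ • fun x ↦ ∑ i, ((fun y ↦ g.inner y (X y) (e i y)) • e i) x := by
    ext1 z
    by_cases hz : z ∈ U
    · simp only [Pi.smul_apply', (he.orthonormal z hz).sum_inner_smul he.finrank]
    · simp [ψ, hz]
  have h1 := hsmul ψ X hψ hX
  have h2 := hsmul ψ (fun x ↦ ∑ i, ((fun y ↦ g.inner y (X y) (e i y)) • e i) x) hψ
    (.sum fun i _ ↦ (he.smooth i).smul (hX.inner g (he.smooth i)))
  rw [hψy, one_smul] at h1 h2
  rw [← h1, ← h2, key]

/-- Consequently the value at `y` depends only on the values of the three fields at `y`, so the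
extensions chosen in `riemann` do not matter. -/
theorem curvatureField_eq_sum [Nonempty (Fin n)] (he : IsOrthonormalFrameOn g U e)
    (hX : SmoothFieldOn U X) (hY : SmoothFieldOn U Y) (hZ : SmoothFieldOn U Z) (hy : y ∈ U) :
    curvatureField g X Y Z y = ∑ i, ∑ j, ∑ l, (g.inner y (X y) (e i y) * g.inner y (Y y) (e j y)
      * g.inner y (Z y) (e l y)) • curvatureField g (e i) (e j) (e l) y := by
  rw [he.tensorial_eq_sum hy (Φ := fun X ↦ curvatureField g X Y Z y)
    (fun _ _ h h' ↦ curvatureField_add_left he h h' hZ hy)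
    (fun _ _ hf h ↦ curvatureField_smul_left he hf h hZ hy) hX]
  refine Finset.sum_congr rfl fun i _ ↦ ?_
  rw [he.tensorial_eq_sum hy (Φ := fun Y ↦ curvatureField g (e i) Y Z y)
    (fun Y Y' h h' ↦ by
      simp only [curvatureField_swap (X := e i)]
      rw [curvatureField_add_left he h h' hZ hy]; abel)
    (fun _ _ hf h ↦ by
      simp only [curvatureField_swap (X := e i)]
      rw [curvatureField_smul_left he hf h hZ hy, smul_neg]) hY, Finset.smul_sum]
  refine Finset.sum_congr rfl fun j _ ↦ ?_
  rw [he.tensorial_eq_sum hy (Φ := fun Z ↦ curvatureField g (e i) (e j) Z y)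
    (fun _ _ h h' ↦ curvatureField_add_right he (he.smooth i) (he.smooth j) h h' hy)
    (fun _ _ hf h ↦ curvatureField_smul_right he hf (he.smooth i) (he.smooth j) h hy) hZ,
    Finset.smul_sum, Finset.smul_sum]
  refine Finset.sum_congr rfl fun l _ ↦ ?_
  rw [smul_smul, smul_smul, mul_assoc]

theorem exists_smoothFieldOn_extend (v : TangentSpace 𝓘(ℝ, E) y) :
    ∃ V : Set M, IsOpen V ∧ y ∈ V ∧ SmoothFieldOn V (extend E v) := by
  obtain ⟨s, hs, h⟩ := exists_contMDiffOn_extend (k := ∞) 𝓘(ℝ, E) E v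
  refine ⟨interior s, isOpen_interior, mem_interior_iff_mem_nhds.2 hs, fun z hz ↦ ?_⟩
  exact h.contMDiffAt (mem_interior_iff_mem_nhds.1 hz)

/-- The curvature tensor can be computed with arbitrary smooth vector fields. -/
theorem riemann_eq_curvatureField [Nonempty (Fin n)] (he : IsOrthonormalFrameOn g U e)
    (hX : SmoothFieldOn U X) (hY : SmoothFieldOn U Y) (hZ : SmoothFieldOn U Z) (hy : y ∈ U)
    (w : TangentSpace 𝓘(ℝ, E) y) :
    riemann g y (X y) (Y y) w (Z y) = g.inner y (curvatureField g X Y Z y) w := by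
  obtain ⟨V₁, hV₁, hy₁, h₁⟩ := exists_smoothFieldOn_extend (X y)
  obtain ⟨V₂, hV₂, hy₂, h₂⟩ := exists_smoothFieldOn_extend (Y y)
  obtain ⟨V₃, hV₃, hy₃, h₃⟩ := exists_smoothFieldOn_extend (Z y)
  -- The chosen extensions are smooth only near `y`, so the frame is restricted to a common
  -- neighbourhood; the expansion at `y` does not change.
  have he' := he.mono (V := U ∩ (V₁ ∩ (V₂ ∩ V₃)))
    (he.isOpen.inter (hV₁.inter (hV₂.inter hV₃))) Set.inter_subset_left
  rw [riemann, curvatureField_eq_sum he hX hY hZ hy,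
    curvatureField_eq_sum he' (fun z hz ↦ h₁ z hz.2.1) (fun z hz ↦ h₂ z hz.2.2.1)
      (fun z hz ↦ h₃ z hz.2.2.2) ⟨hy, hy₁, hy₂, hy₃⟩]
  simp only [extend_apply_self]

/-- The curvature tensor is multilinear. -/
theorem riemann_eq_sum [Nonempty (Fin n)] (he : IsOrthonormalFrameOn g U e) (hy : y ∈ U)
    (u v w z : TangentSpace 𝓘(ℝ, E) y) :
    riemann g y u v w z = ∑ i, ∑ j, ∑ k, ∑ l, g.inner y u (e i y) * g.inner y v (e j y)
      * g.inner y w (e k y) * g.inner y z (e l y)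
      * riemann g y (e i y) (e j y) (e k y) (e l y) := by
  obtain ⟨V₁, hV₁, hy₁, h₁⟩ := exists_smoothFieldOn_extend u
  obtain ⟨V₂, hV₂, hy₂, h₂⟩ := exists_smoothFieldOn_extend v
  obtain ⟨V₃, hV₃, hy₃, h₃⟩ := exists_smoothFieldOn_extend z
  have he' := he.mono (V := U ∩ (V₁ ∩ (V₂ ∩ V₃)))
    (he.isOpen.inter (hV₁.inter (hV₂.inter hV₃))) Set.inter_subset_left
  rw [riemann, curvatureField_eq_sum he' (fun z hz ↦ h₁ z hz.2.1) (fun z hz ↦ h₂ z hz.2.2.1)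
      (fun z hz ↦ h₃ z hz.2.2.2) ⟨hy, hy₁, hy₂, hy₃⟩]
  simp only [extend_apply_self]
  simp only [map_sum, map_smul, sum_apply, smul_apply, smul_eq_mul]
  refine Finset.sum_congr rfl fun i _ ↦ Finset.sum_congr rfl fun j _ ↦ ?_
  conv_rhs => rw [Finset.sum_comm]
  refine Finset.sum_congr rfl fun l _ ↦ ?_
  conv_lhs => rw [← (he.orthonormal y hy).sum_inner_smul he.finrank w]
  simp only [map_sum, map_smul, smul_eq_mul, Finset.mul_sum]
  refine Finset.sum_congr rfl fun k _ ↦ ?_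
  rw [riemann_eq_curvatureField he (he.smooth i) (he.smooth j) (he.smooth l) hy]
  ring

end Frames

/-! ### Connection coefficients and curvature in an orthonormal frame -/

section FrameFormulas

open VectorField FiberBundle

variable {E : Type*} [NormedAddCommGroup E] [NormedSpace ℝ E]
  {M : Type*} [TopologicalSpace M] [ChartedSpace E M] [IsManifold 𝓘(ℝ, E) ∞ M]
  {g : Metric E M}
  {U : Set M} {f : M → ℝ} {X X' Y Z W : Π x : M, TangentSpace 𝓘(ℝ, E) x} {y : M} {n : ℕ}
  {e : Fin n → Π x : M, TangentSpace 𝓘(ℝ, E) x}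

/-- Absence of torsion, at the level of the Koszul formula. -/
theorem koszul_sub_koszul_swap : koszul g X Y Z y - koszul g Y X Z y =
    g.inner y (mlieBracket 𝓘(ℝ, E) X Y y) (Z y) := by
  have h : (fun y ↦ g.inner y (Y y) (X y)) = fun y ↦ g.inner y (X y) (Y y) := by
    ext y; exact g.symm ..
  simp only [koszul, h, mlieBracket_swap_apply (V := Y) (W := X), map_neg, neg_apply]
  ring

/-- Compatibility with the metric, at the level of the Koszul formula. -/
theorem koszul_add_koszul_swap : koszul g X Y Z y + koszul g X Z Y y =
    d% (fun y ↦ g.inner y (Y y) (Z y)) y (X y) := by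
  have h : (fun y ↦ g.inner y (Z y) (Y y)) = fun y ↦ g.inner y (Y y) (Z y) := by
    ext y; exact g.symm ..
  simp only [koszul, h, mlieBracket_swap_apply (V := Z) (W := Y), map_neg, neg_apply]
  ring

variable [FiniteDimensional ℝ E]

theorem mvfderiv_eq_zero_of_eqOn_const (hU : IsOpen U) {c : ℝ} (hf : ∀ y ∈ U, f y = c)
    (hy : y ∈ U) : d% f y = 0 := by
  have : f =ᶠ[𝓝 y] fun _ ↦ c := Filter.eventuallyEq_of_mem (hU.mem_nhds hy) hf
  rw [mvfderiv, this.mfderiv_eq]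
  exact mvfderiv_const c

theorem mvfderiv_congr_of_eqOn {h : M → ℝ} (hU : IsOpen U) (hf : ∀ y ∈ U, f y = h y)
    (hy : y ∈ U) : d% f y = d% h y := by
  have : f =ᶠ[𝓝 y] h := Filter.eventuallyEq_of_mem (hU.mem_nhds hy) hf
  rw [mvfderiv, mvfderiv, this.mfderiv_eq, this.eq_of_nhds]

namespace IsOrthonormalFrameOn

theorem koszul_skew (he : IsOrthonormalFrameOn g U e) (hy : y ∈ U) (i j k : Fin n) :
    koszul g (e i) (e j) (e k) y = -koszul g (e i) (e k) (e j) y := by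
  have h := koszul_add_koszul_swap (g := g) (X := e i) (Y := e j) (Z := e k) (y := y)
  rw [mvfderiv_eq_zero_of_eqOn_const he.isOpen (fun y hy ↦ he.orthonormal y hy j k) hy] at h
  rw [zero_apply] at h
  linarith

theorem inner_mlieBracket (i j k : Fin n) :
    g.inner y (mlieBracket 𝓘(ℝ, E) (e i) (e j) y) (e k y) =
      koszul g (e i) (e j) (e k) y - koszul g (e j) (e i) (e k) y :=
  koszul_sub_koszul_swap.symm

theorem mlieBracket_eq_sum (he : IsOrthonormalFrameOn g U e) (hy : y ∈ U) (i j : Fin n) :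
    mlieBracket 𝓘(ℝ, E) (e i) (e j) y =
      ∑ k, (koszul g (e i) (e j) (e k) y - koszul g (e j) (e i) (e k) y) • e k y := by
  rw [← (he.orthonormal y hy).sum_inner_smul he.finrank (mlieBracket 𝓘(ℝ, E) (e i) (e j) y)]
  simp only [inner_mlieBracket]

theorem smooth_mvfderiv (he : IsOrthonormalFrameOn g U e) (hf : SmoothFunOn E U f) (i : Fin n) :
    SmoothFunOn E U fun y ↦ d% f y (e i y) :=
  hf.mvfderiv_of_unit g he.isOpen (he.smooth i) (he.smooth i) fun y hy ↦ by
    rw [he.orthonormal y hy i i, if_pos rfl]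

theorem mvfderiv_comm (he : IsOrthonormalFrameOn g U e) (hf : SmoothFunOn E U f) (hy : y ∈ U)
    (i j : Fin n) :
    d% (fun y ↦ d% f y (e j y)) y (e i y) - d% (fun y ↦ d% f y (e i y)) y (e j y) =
      ∑ k, (koszul g (e i) (e j) (e k) y - koszul g (e j) (e i) (e k) y) * d% f y (e k y) := by
  rw [← mvfderiv_mlieBracket g he.isOpen hf (he.smooth i) (he.smooth j) (he.smooth i) (fun y hy ↦ by
    rw [he.orthonormal y hy i i, if_pos rfl]) hy, he.mlieBracket_eq_sum hy, map_sum]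
  simp

theorem inner_leviCivita_leviCivita (he : IsOrthonormalFrameOn g U e) (hy : y ∈ U)
    (i j l k : Fin n) :
    g.inner y (leviCivita g (fun y ↦ leviCivita g (e l) y (e j y)) y (e i y)) (e k y) =
      d% (koszul g (e j) (e l) (e k)) y (e i y)
      + ∑ a, koszul g (e j) (e l) (e a) y * koszul g (e i) (e a) (e k) y := by
  have hs : ∀ a, SmoothFunOn E U (koszul g (e j) (e l) (e a)) := fun a ↦
    koszul_smooth he i (he.smooth j) (he.smooth l) (he.smooth a)
  have hs' : ∀ a ∈ Finset.univ, SmoothFieldOn U (koszul g (e j) (e l) (e a) • e a) := fun a _ ↦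
    (he.smooth a).smul (hs a)
  rw [leviCivita_congr he.isOpen (SmoothFieldOn.sum hs')
    (fun y hy ↦ leviCivita_eq_sum he (he.smooth j) (he.smooth l) hy) hy,
    leviCivita_sum hs' hy]
  simp only [sum_apply, leviCivita_smul (hs _) (he.smooth _) hy, map_sum, map_add, map_smul,
    add_apply, smul_apply, smul_eq_mul, inner_leviCivita (he.smooth _) (he.smooth _) (he.smooth _) hy,
    Finset.sum_add_distrib, he.orthonormal y hy _ _]
  simp
  ring

/-- The structure equation for the curvature tensor. -/
theorem riemann_eq (he : IsOrthonormalFrameOn g U e) (hy : y ∈ U) (i j k l : Fin n) :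
    riemann g y (e i y) (e j y) (e k y) (e l y) =
      d% (koszul g (e j) (e l) (e k)) y (e i y) - d% (koszul g (e i) (e l) (e k)) y (e j y)
      + ∑ a, (koszul g (e j) (e l) (e a) y * koszul g (e i) (e a) (e k) y
        - koszul g (e i) (e l) (e a) y * koszul g (e j) (e a) (e k) y)
      - ∑ a, (koszul g (e i) (e j) (e a) y - koszul g (e j) (e i) (e a) y)
        * koszul g (e a) (e l) (e k) y := by
  have : Nonempty (Fin n) := ⟨i⟩
  rw [riemann_eq_curvatureField he (he.smooth i) (he.smooth j) (he.smooth l) hy, curvatureField,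
    he.mlieBracket_eq_sum hy i j]
  simp only [map_sub, sub_apply, he.inner_leviCivita_leviCivita hy, map_sum, map_smul, sum_apply,
    smul_apply, inner_leviCivita (he.smooth _) (he.smooth _) (he.smooth _) hy, smul_eq_mul,
    Finset.sum_sub_distrib]
  ring

theorem smooth_riemann (he : IsOrthonormalFrameOn g U e) (i j k l : Fin n) :
    SmoothFunOn E U fun y ↦ riemann g y (e i y) (e j y) (e k y) (e l y) := by
  have : Nonempty (Fin n) := ⟨i⟩
  have h : SmoothFieldOn U (curvatureField g (e i) (e j) (e l)) :=
    ((he.smooth i).leviCivita he ((he.smooth j).leviCivita he (he.smooth l))).sub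
      ((he.smooth j).leviCivita he ((he.smooth i).leviCivita he (he.smooth l))) |>.sub
      (((he.smooth i).mlieBracket (he.smooth j)).leviCivita he (he.smooth l))
  exact (h.inner g (he.smooth k)).congr he.isOpen fun y hy ↦
    riemann_eq_curvatureField he (he.smooth i) (he.smooth j) (he.smooth l) hy _

end IsOrthonormalFrameOn

/-! ### Existence of orthonormal frames -/

theorem exists_isOrthonormalFrame (g : Metric E M) (hn : Module.finrank ℝ E = n) (x : M) :
    ∃ e : Fin n → TangentSpace 𝓘(ℝ, E) x, IsOrthonormalFrame g x e := by
  subst hn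
  let B : LinearMap.BilinForm ℝ (TangentSpace 𝓘(ℝ, E) x) :=
    LinearMap.mk₂ ℝ (fun v w ↦ g.inner x v w) (by simp) (by simp) (by simp) (by simp)
  have hB : ∀ v w, B v w = g.inner x v w := fun _ _ ↦ rfl
  obtain ⟨v, hv⟩ := LinearMap.BilinForm.exists_orthogonal_basis (B := B) ⟨fun v w ↦ g.symm x v w⟩
  have hfr : Module.finrank ℝ (TangentSpace 𝓘(ℝ, E) x) = Module.finrank ℝ E := rfl
  let w : Fin (Module.finrank ℝ E) → TangentSpace 𝓘(ℝ, E) x := fun i ↦ v (Fin.cast hfr.symm i)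
  have hw : ∀ i j, i ≠ j → g.inner x (w i) (w j) = 0 := fun i j hij ↦
    hv (fun h ↦ hij (by simpa using h))
  have hpos : ∀ i, 0 < g.inner x (w i) (w i) := fun i ↦ g.pos x _ (v.ne_zero _)
  refine ⟨fun i ↦ (√(g.inner x (w i) (w i)))⁻¹ • w i, fun i j ↦ ?_⟩
  simp only [map_smul, smul_apply, smul_eq_mul]
  split_ifs with h
  · subst h
    have := Real.mul_self_sqrt (hpos i).le
    have h0 := (Real.sqrt_pos.2 (hpos i)).ne'
    field_simp
    rw [sq, this]
  · rw [hw i j h]; ring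

/-- Every orthonormal basis of a tangent space extends to a smooth orthonormal frame. -/
theorem exists_isOrthonormalFrameOn (hn : Module.finrank ℝ E = n) {x : M}
    {b : Fin n → TangentSpace 𝓘(ℝ, E) x} (hb : IsOrthonormalFrame g x b) :
    ∃ (U : Set M) (e : Fin n → Π x : M, TangentSpace 𝓘(ℝ, E) x), x ∈ U ∧
      IsOrthonormalFrameOn g U e ∧ ∀ i, e i x = b i := by
  classical
  -- Gram–Schmidt, one field at a time, with the neighbourhood of `x` shrinking at each step.
  suffices H : ∀ s : Finset (Fin n), ∃ (U : Set M) (e : Fin n → Π x : M, TangentSpace 𝓘(ℝ, E) x),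
      x ∈ U ∧ IsOpen U ∧ (∀ i ∈ s, SmoothFieldOn U (e i)) ∧ (∀ i ∈ s, e i x = b i) ∧
      ∀ y ∈ U, ∀ i ∈ s, ∀ j ∈ s, g.inner y (e i y) (e j y) = if i = j then 1 else 0 by
    obtain ⟨U, e, hx, hU, hs, hb, ho⟩ := H Finset.univ
    exact ⟨U, e, hx, ⟨hU, fun i ↦ hs i (Finset.mem_univ i), fun y hy i j ↦
      ho y hy i (Finset.mem_univ i) j (Finset.mem_univ j), hn⟩, fun i ↦ hb i (Finset.mem_univ i)⟩
  intro s
  induction s using Finset.induction_on with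
  | empty => exact ⟨Set.univ, fun _ _ ↦ 0, trivial, isOpen_univ, by simp, by simp, by simp⟩
  | insert a s ha ih =>
    obtain ⟨U, e, hx, hU, hs, heb, ho⟩ := ih
    obtain ⟨V, hV, hxV, hXV⟩ := exists_smoothFieldOn_extend (b a)
    set X := extend E (b a) with hX
    have hXx : X x = b a := extend_apply_self ..
    let Y : Π x : M, TangentSpace 𝓘(ℝ, E) x :=
      X - fun y ↦ ∑ i ∈ s, ((fun y ↦ g.inner y (X y) (e i y)) • e i) y
    have hXs : SmoothFieldOn (U ∩ V) X := fun y hy ↦ hXV y hy.2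
    have hes : ∀ i ∈ s, SmoothFieldOn (U ∩ V) (e i) := fun i hi y hy ↦ hs i hi y hy.1
    have hYs : SmoothFieldOn (U ∩ V) Y :=
      hXs.sub (.sum fun i hi ↦ (hes i hi).smul (hXs.inner g (hes i hi)))
    have hYx : Y x = b a := by
      have : ∀ i ∈ s, g.inner x (b a) (e i x) • e i x = 0 := fun i hi ↦ by
        rw [heb i hi, hb, if_neg (by rintro rfl; exact ha hi), zero_smul]
      simp only [Y, Pi.sub_apply, Pi.smul_apply', hXx, Finset.sum_eq_zero this, sub_zero]
    have hYo : ∀ y ∈ U, ∀ j ∈ s, g.inner y (Y y) (e j y) = 0 := fun y hy j hj ↦ by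
      simp only [Y, Pi.sub_apply, Pi.smul_apply', map_sub, map_sum, map_smul, sub_apply, sum_apply,
        smul_apply, smul_eq_mul]
      rw [Finset.sum_congr rfl fun i hi ↦ by rw [ho y hy i hi j hj]]
      simp [hj]
    have hq := hYs.inner g hYs
    have hqc : ContinuousOn (fun y ↦ g.inner y (Y y) (Y y)) (U ∩ V) := fun y hy ↦
      (hq y hy).continuousAt.continuousWithinAt
    -- Normalisation needs `Y ≠ 0`. This holds at `x`, where `Y` equals the unit vector `b a`, hence
    -- nearby.
    have hW := hqc.isOpen_inter_preimage (hU.inter hV) (isOpen_Ioi (a := (0 : ℝ)))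
    set W := U ∩ V ∩ (fun y ↦ g.inner y (Y y) (Y y)) ⁻¹' Set.Ioi 0
    let r : M → ℝ := fun y ↦ (√(g.inner y (Y y) (Y y)))⁻¹
    have hpos : ∀ y ∈ W, 0 < g.inner y (Y y) (Y y) := fun y hy ↦ hy.2
    have hr : SmoothFunOn E W r := fun y hy ↦ by
      have h1 : ContDiffAt ℝ ∞ (fun t : ℝ ↦ (√t)⁻¹) (g.inner y (Y y) (Y y)) :=
        (Real.contDiffAt_sqrt (hpos y hy).ne').inv (Real.sqrt_pos.2 (hpos y hy)).ne'
      exact ContMDiffAt.comp (g := fun t : ℝ ↦ (√t)⁻¹) y h1.contMDiffAt (hq y hy.1)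
    refine ⟨W, Function.update e a (r • Y), ⟨⟨hx, hxV⟩, ?_⟩, hW, ?_, ?_, ?_⟩
    · show 0 < g.inner x (Y x) (Y x)
      rw [hYx, hb, if_pos rfl]
      exact one_pos
    · intro i hi
      rcases Finset.mem_insert.1 hi with rfl | his
      · rw [Function.update_self]
        exact SmoothFieldOn.smul hr fun y hy ↦ hYs y hy.1
      · rw [Function.update_of_ne (by rintro rfl; exact ha his)]
        exact fun y hy ↦ hs i his y hy.1.1
    · intro i hi
      rcases Finset.mem_insert.1 hi with rfl | his
      · rw [Function.update_self, Pi.smul_apply', hYx]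
        simp only [r, hYx]
        rw [hb, if_pos rfl]
        simp
      · rw [Function.update_of_ne (by rintro rfl; exact ha his), heb i his]
    · intro y hy
      have hne : ∀ i ∈ s, i ≠ a := fun i hi ↦ by rintro rfl; exact ha hi
      have hrY : ∀ j ∈ s, g.inner y ((r • Y) y) (e j y) = 0 := fun j hj ↦ by
        rw [Pi.smul_apply', map_smul, smul_apply, hYo y hy.1.1 j hj, smul_zero]
      intro i hi j hj
      rcases Finset.mem_insert.1 hi with hia | his <;> rcases Finset.mem_insert.1 hj with hja | hjs
      · subst hia
        subst hja
        rw [Function.update_self, if_pos rfl, Pi.smul_apply', map_smul, map_smul, smul_apply,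
          smul_eq_mul, smul_eq_mul]
        have h1 := Real.mul_self_sqrt (hpos y hy).le
        have h0 := (Real.sqrt_pos.2 (hpos y hy)).ne'
        simp only [r]
        field_simp
        rw [sq, h1]
      · subst hia
        rw [Function.update_self, Function.update_of_ne (hne j hjs), hrY j hjs,
          if_neg (hne j hjs).symm]
      · subst hja
        rw [Function.update_self, Function.update_of_ne (hne i his), g.symm, hrY i his,
          if_neg (hne i his)]
      · rw [Function.update_of_ne (hne i his), Function.update_of_ne (hne j hjs)]
        exact ho y hy.1.1 i his j hjs

end FrameFormulas

section SmoothAlgebra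

variable {E : Type*} [NormedAddCommGroup E] [NormedSpace ℝ E]
  {M : Type*} [TopologicalSpace M] [ChartedSpace E M] [IsManifold 𝓘(ℝ, E) ∞ M]

/-! ### The algebra of smooth functions on an open set -/

/-- Extension by zero of a function on `U`. -/
def extendZero {U : Set M} (f : U → ℝ) : M → ℝ := Function.extend Subtype.val f 0

theorem extendZero_coe {U : Set M} (f : U → ℝ) (y : U) : extendZero f y = f y :=
  Subtype.val_injective.extend_apply ..

theorem extendZero_of_notMem {U : Set M} (f : U → ℝ) {y : M} (hy : y ∉ U) : extendZero f y = 0 :=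
  Function.extend_apply' _ _ _ fun ⟨z, hz⟩ ↦ hy (hz ▸ z.2)

theorem extendZero_add {U : Set M} (f h : U → ℝ) :
    extendZero (f + h) = extendZero f + extendZero h := by
  ext y
  by_cases hy : y ∈ U
  · lift y to U using hy
    simp [extendZero_coe]
  · simp [extendZero_of_notMem _ hy]

theorem extendZero_mul {U : Set M} (f h : U → ℝ) :
    extendZero (f * h) = extendZero f * extendZero h := by
  ext y
  by_cases hy : y ∈ U
  · lift y to U using hy
    simp [extendZero_coe]
  · simp [extendZero_of_notMem _ hy]

/-- The algebra of smooth functions on an open subset of a manifold. -/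
def smoothAlgebra (E : Type*) [NormedAddCommGroup E] [NormedSpace ℝ E] {M : Type*}
    [TopologicalSpace M] [ChartedSpace E M] [IsManifold 𝓘(ℝ, E) ∞ M] {U : Set M} (hU : IsOpen U) :
    Subalgebra ℝ (U → ℝ) where
  carrier := {f | SmoothFunOn E U (extendZero f)}
  add_mem' hf hh := by
    simp only [Set.mem_ofPred_eq, extendZero_add]
    exact SmoothFunOn.add hf hh
  mul_mem' hf hh := by
    simp only [Set.mem_ofPred_eq, extendZero_mul]
    exact SmoothFunOn.mul hf hh
  algebraMap_mem' c := (SmoothFunOn.const c).congr hU fun y hy ↦ extendZero_coe _ ⟨y, hy⟩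

variable {U : Set M} {hU : IsOpen U} {f : M → ℝ}

/-- The restriction to `U` of a function which is smooth on `U`. -/
def SmoothFunOn.restrict (hU : IsOpen U) (hf : SmoothFunOn E U f) : smoothAlgebra E hU :=
  ⟨fun y ↦ f y, hf.congr hU fun y hy ↦ extendZero_coe _ ⟨y, hy⟩⟩

/-- Evaluation of smooth functions at a point. -/
def evalAt (E : Type*) [NormedAddCommGroup E] [NormedSpace ℝ E] {M : Type*}
    [TopologicalSpace M] [ChartedSpace E M] [IsManifold 𝓘(ℝ, E) ∞ M] {U : Set M} (hU : IsOpen U)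
    (y : U) :
    smoothAlgebra E hU →+* ℝ :=
  (Pi.evalRingHom _ y).comp (smoothAlgebra E hU).val.toRingHom

theorem evalAt_restrict (hf : SmoothFunOn E U f) (y : U) :
    evalAt E hU y (hf.restrict hU) = f y := rfl

theorem smoothAlgebra_ext {F G : smoothAlgebra E hU} (h : ∀ y, evalAt E hU y F = evalAt E hU y G) :
    F = G :=
  Subtype.ext (funext h)

theorem evalAt_act {n : ℕ} (y : U) (X : Fin n → Fin n → smoothAlgebra E hU)
    (T : Fin n → Fin n → Fin n → Fin n → smoothAlgebra E hU) (i j k l : Fin n) :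
    evalAt E hU y (act X T i j k l) = act (fun i j ↦ evalAt E hU y (X i j))
      (fun i j k l ↦ evalAt E hU y (T i j k l)) i j k l := by
  simp [act]

end SmoothAlgebra

/-! ### The Levi-Civita connection as a `FrameConnection` -/

section FrameAlgebra

variable {E : Type*} [NormedAddCommGroup E] [NormedSpace ℝ E]
  {M : Type*} [TopologicalSpace M] [ChartedSpace E M] [IsManifold 𝓘(ℝ, E) ∞ M]
  [FiniteDimensional ℝ E] {g : Metric E M}
  {U : Set M} {f : M → ℝ} {n : ℕ} {e : Fin n → Π x : M, TangentSpace 𝓘(ℝ, E) x}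

namespace IsOrthonormalFrameOn

/-- The derivative in the direction of a frame vector. -/
def derivation (he : IsOrthonormalFrameOn g U e) (i : Fin n) :
    Derivation ℝ (smoothAlgebra E he.isOpen) (smoothAlgebra E he.isOpen) :=
  .mk'
    { toFun := fun F ↦ (he.smooth_mvfderiv F.2 i).restrict he.isOpen
      map_add' := fun F G ↦ smoothAlgebra_ext fun y ↦ by
        have := mvfderiv_add (SmoothFunOn.mdiffAt F.2 y.2) (SmoothFunOn.mdiffAt G.2 y.2)
        simp only [map_add, evalAt_restrict, Subalgebra.coe_add, extendZero_add]
        rw [this, add_apply]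
      map_smul' := fun c F ↦ smoothAlgebra_ext fun y ↦ by
        have hc : extendZero (c • F.1) = (fun _ ↦ c) * extendZero F.1 := by
          ext z
          by_cases hz : z ∈ U
          · lift z to U using hz
            simp [extendZero_coe]
          · simp [extendZero_of_notMem _ hz]
        have := mvfderiv_mul ((SmoothFunOn.const (E := E) (U := U) c).mdiffAt y.2)
          (SmoothFunOn.mdiffAt F.2 y.2)
        simp only [RingHom.id_apply, Algebra.smul_def, map_mul, evalAt_restrict]
        rw [← Algebra.smul_def, Subalgebra.coe_smul, hc, this, mvfderiv_const]
        simp only [add_apply, smul_apply, smul_eq_mul, zero_apply, mul_zero, add_zero]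
        rfl }
    fun F G ↦ smoothAlgebra_ext fun y ↦ by
      have := mvfderiv_mul (SmoothFunOn.mdiffAt F.2 y.2) (SmoothFunOn.mdiffAt G.2 y.2)
      simp only [LinearMap.coe_mk, AddHom.coe_mk, smul_eq_mul, map_add, map_mul, evalAt_restrict,
        Subalgebra.coe_mul, extendZero_mul]
      rw [this]
      simp only [add_apply, smul_apply, smul_eq_mul, extendZero_coe]
      rfl

theorem derivation_restrict (he : IsOrthonormalFrameOn g U e) (i : Fin n) (hf : SmoothFunOn E U f) :
    he.derivation i (hf.restrict he.isOpen) = (he.smooth_mvfderiv hf i).restrict he.isOpen :=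
  smoothAlgebra_ext fun y ↦ congrArg (fun L ↦ L (e i y)) <|
    mvfderiv_congr_of_eqOn he.isOpen (fun z hz ↦ extendZero_coe _ ⟨z, hz⟩) y.2

theorem smooth_koszul (he : IsOrthonormalFrameOn g U e) (i j k : Fin n) :
    SmoothFunOn E U (koszul g (e i) (e j) (e k)) :=
  koszul_smooth he i (he.smooth i) (he.smooth j) (he.smooth k)

/-- The Levi-Civita connection in an orthonormal frame. -/
def frameConnection (he : IsOrthonormalFrameOn g U e) :
    FrameConnection n (smoothAlgebra E he.isOpen) where
  D := he.derivation
  Γ i j k := (he.smooth_koszul i j k).restrict he.isOpen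
  skew i j k := smoothAlgebra_ext fun y ↦ he.koszul_skew y.2 i j k
  comm i j F := smoothAlgebra_ext fun y ↦ by
    have h := he.mvfderiv_comm F.2 y.2 i j
    have hD : ∀ i (F : smoothAlgebra E he.isOpen), he.derivation i F =
      (he.smooth_mvfderiv F.2 i).restrict he.isOpen := fun _ _ ↦ rfl
    rw [hD j F, hD i F, derivation_restrict, derivation_restrict]
    simp only [map_sub, map_sum, map_mul, evalAt_restrict, hD _ F]
    exact h

theorem frameConnection_curv (he : IsOrthonormalFrameOn g U e) (i j k l : Fin n) :
    he.frameConnection.curv i j k l =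
    (he.smooth_riemann i j k l).restrict he.isOpen := smoothAlgebra_ext fun y ↦ by
  simp only [FrameConnection.curv, FrameConnection.bracket, frameConnection, derivation_restrict,
    map_sub, map_add, map_sum, map_mul, evalAt_restrict]
  exact (he.riemann_eq y.2 i j k l).symm

/-- The symmetries are read off from membership in `algCurv`; the Einstein constant enters as a
scalar, which every derivation kills. -/
theorem isEinsteinCurv (he : IsOrthonormalFrameOn g U e) {ρ : ℝ}
    (hR : ∀ y ∈ U, curvatureComponents g y (fun i ↦ e i y) ∈ algCurv n)
    (hρ : ∀ y ∈ U, ∀ u v : TangentSpace 𝓘(ℝ, E) y,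
      ∑ i, riemann g y u (e i y) v (e i y) = ρ * g.inner y u v) :
    he.frameConnection.IsEinsteinCurv (algebraMap ℝ _ ρ) where
  skew_left i j k l := smoothAlgebra_ext fun y ↦ by
    simp only [frameConnection_curv, map_neg, evalAt_restrict]
    exact (hR y y.2).1 i j k l
  skew_right i j k l := smoothAlgebra_ext fun y ↦ by
    simp only [frameConnection_curv, map_neg, evalAt_restrict]
    exact (hR y y.2).2.1 i j k l
  pair i j k l := smoothAlgebra_ext fun y ↦ by
    simp only [frameConnection_curv, evalAt_restrict]
    exact (hR y y.2).2.2.1 i j k l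
  bianchi i j k l := smoothAlgebra_ext fun y ↦ by
    simp only [frameConnection_curv, map_add, map_zero, evalAt_restrict]
    exact (hR y y.2).2.2.2 i j k l
  const m := Derivation.map_algebraMap ..
  ricci i k := smoothAlgebra_ext fun y ↦ by
    have h := hρ y y.2 (e i y) (e k y)
    rw [he.orthonormal y y.2 i k] at h
    simp only [frameConnection_curv, map_sum, evalAt_restrict, h]
    split_ifs
    · rw [mul_one]; rfl
    · simp

/-- The Laplacian of the curvature tensor of an Einstein metric, in an orthonormal frame. -/
theorem laplacian_riemann (he : IsOrthonormalFrameOn g U e) {ρ : ℝ}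
    (hR : ∀ y ∈ U, curvatureComponents g y (fun i ↦ e i y) ∈ algCurv n)
    (hρ : ∀ y ∈ U, ∀ u v : TangentSpace 𝓘(ℝ, E) y,
      ∑ i, riemann g y u (e i y) v (e i y) = ρ * g.inner y u v) {y : M} (hy : y ∈ U)
    {R : M → Fin n → Fin n → Fin n → Fin n → ℝ}
    (hRdef : R = fun y ↦ curvatureComponents g y fun i ↦ e i y)
    {Γ : Fin n → Fin n → Fin n → ℝ} (hΓ : Γ = fun i j k ↦ koszul g (e i) (e j) (e k) y)
    {DR : Fin n → Fin n → Fin n → Fin n → Fin n → ℝ}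
    (hDR : DR = fun m i j k l ↦ d% (fun y ↦ R y i j k l) y (e m y)) (i j k l : Fin n) :
    ∑ m, (d% (fun y ↦ d% (fun y ↦ R y i j k l) y (e m y)) y (e m y)
      - act (fun i j ↦ d% (koszul g (e m) (e i) (e j)) y (e m y)) (R y) i j k l
      - 2 * act (Γ m) (DR m) i j k l + act (Γ m) (act (Γ m) (R y)) i j k l
      - ∑ a, Γ m m a * (DR a i j k l - act (Γ a) (R y) i j k l)) =
    2 * ρ * R y i j k l - hamiltonFun (R y) i j k l := by
  -- The abstract identity is evaluated at `y`; all that follows translates each abstract term into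
  -- a derivative on `M`.
  have key := congrArg (evalAt E he.isOpen ⟨y, hy⟩)
    ((he.isEinsteinCurv hR hρ).sum_nabla₂_curv i j k l)
  have hT : he.frameConnection.curv = fun i j k l ↦
      (he.smooth_riemann i j k l).restrict he.isOpen := by
    ext1; ext1; ext1; ext1; exact he.frameConnection_curv ..
  rw [hT] at key
  have hn : ∀ m (T : Fin n → Fin n → Fin n → Fin n → smoothAlgebra E he.isOpen),
      he.frameConnection.nabla m T =
        (fun i j k l ↦ he.derivation m (T i j k l)) - act (he.frameConnection.Γ m) T :=
    fun _ _ ↦ rfl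
  have hG : ∀ i j k, evalAt E he.isOpen ⟨y, hy⟩ (he.frameConnection.Γ i j k) = Γ i j k :=
    fun i j k ↦ by rw [hΓ]; rfl
  have hDG : ∀ m i j, evalAt E he.isOpen ⟨y, hy⟩
      (he.derivation m (he.frameConnection.Γ m i j)) =
        d% (koszul g (e m) (e i) (e j)) y (e m y) := fun m i j ↦ by
    have : he.frameConnection.Γ m i j = (he.smooth_koszul m i j).restrict he.isOpen := rfl
    rw [this, derivation_restrict, evalAt_restrict]
  have hD1 : ∀ m i j k l, evalAt E he.isOpen ⟨y, hy⟩
      (he.derivation m ((he.smooth_riemann i j k l).restrict he.isOpen)) = DR m i j k l :=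
    fun m i j k l ↦ by
      rw [derivation_restrict, evalAt_restrict, hDR, hRdef]; rfl
  have hR0 : ∀ i j k l, evalAt E he.isOpen ⟨y, hy⟩
      ((he.smooth_riemann i j k l).restrict he.isOpen) = R y i j k l := fun i j k l ↦ by
    rw [hRdef]; rfl
  have hD2 : ∀ m i j k l, evalAt E he.isOpen ⟨y, hy⟩
      (he.derivation m (he.derivation m ((he.smooth_riemann i j k l).restrict he.isOpen))) =
        d% (fun y ↦ d% (fun y ↦ R y i j k l) y (e m y)) y (e m y) := fun m i j k l ↦ by
    rw [derivation_restrict, derivation_restrict, evalAt_restrict, hRdef]; rfl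
  have hρ' : evalAt E he.isOpen ⟨y, hy⟩ (algebraMap ℝ _ ρ) = ρ := rfl
  have hact : ∀ m, act (Γ m) (DR m - act (Γ m) (R y)) i j k l =
      act (Γ m) (DR m) i j k l - act (Γ m) (act (Γ m) (R y)) i j k l := fun m ↦ by
    rw [act_sub_right]; rfl
  simp only [FrameConnection.nabla₂, hn, Pi.sub_apply, map_sub, map_sum, map_mul, map_add, hG,
    evalAt_act, hR0, hD1, hD2, hρ', derivation_act, hDG, map_ofNat] at key
  rw [hamiltonFun]
  rw [← key]
  refine Finset.sum_congr rfl fun m _ ↦ ?_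
  have := hact m
  simp only [Pi.sub_def] at this
  rw [this]
  ring

end IsOrthonormalFrameOn

end FrameAlgebra

/-! ### Linear algebra of curvature tensors -/

section Unit

variable {n : ℕ}

theorem sum_unitCurv_mul (i j k l : Fin n) (T : Fin n → Fin n → Fin n → Fin n → ℝ) :
    ∑ p, ∑ q, (unitCurv n).1 i j p q * T k l p q = T k l i j - T k l j i := by
  simp [unitCurv, sub_mul, Finset.sum_sub_distrib]

theorem sum_unitCurv_mul_swap (i k j l : Fin n) (T : Fin n → Fin n → Fin n → Fin n → ℝ) :
    ∑ p, ∑ q, (unitCurv n).1 i p k q * T j p l q =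
      (if i = k then ∑ p, T j p l p else 0) - T j k l i := by
  simp [unitCurv, sub_mul, Finset.sum_sub_distrib]

theorem sum_unitCurv (i k : Fin n) :
    ∑ p, (unitCurv n).1 i p k p = if i = k then (n - 1 : ℝ) else 0 := by
  simp only [unitCurv, if_true, mul_one, Finset.sum_sub_distrib, Finset.sum_const,
    Finset.card_univ, Fintype.card_fin]
  by_cases h : i = k <;> simp [h]

/-- `Q` is quadratic, and by the first Bianchi identity its polarisation against `I` sees only the
Ricci tensor of `R`; for Einstein `R` that part is a multiple of `I`. The last coefficient reflects
`Q(I) = 2(n - 1) I`. -/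
theorem hamiltonFun_sub_unitCurv {R : Fin n → Fin n → Fin n → Fin n → ℝ} (hR : R ∈ algCurv n)
    {ρ : ℝ} (hρ : ∀ i k, ∑ p, R i p k p = if i = k then ρ else 0) (κ : ℝ) (i j k l : Fin n) :
    hamiltonFun (R - κ • (unitCurv n).1) i j k l = hamiltonFun R i j k l
      - 4 * κ * ρ * (unitCurv n).1 i j k l + 2 * (n - 1) * κ ^ 2 * (unitCurv n).1 i j k l := by
  set I := (unitCurv n).1 with hI
  have e1 : ∀ T : Fin n → Fin n → Fin n → Fin n → ℝ, ∀ i j k l,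
      ∑ p, ∑ q, T k l p q * I i j p q = T k l i j - T k l j i := fun T i j k l ↦ by
    simp only [← sum_unitCurv_mul, mul_comm, hI]
  have e2 : ∀ T : Fin n → Fin n → Fin n → Fin n → ℝ, ∀ i j k l,
      ∑ p, ∑ q, T j p l q * I i p k q = (if i = k then ∑ p, T j p l p else 0) - T j k l i :=
    fun T i j k l ↦ by
    simp only [← sum_unitCurv_mul_swap, mul_comm, hI]
  have hIm : I ∈ algCurv n := (unitCurv n).2
  have main : hamiltonFun (R - κ • I) i j k l = hamiltonFun R i j k l
      - κ * (∑ p, ∑ q, I i j p q * R k l p q + ∑ p, ∑ q, R i j p q * I k l p q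
        + 2 * (∑ p, ∑ q, I i p k q * R j p l q + ∑ p, ∑ q, R i p k q * I j p l q
        - ∑ p, ∑ q, I i p l q * R j p k q - ∑ p, ∑ q, R i p l q * I j p k q))
      + κ ^ 2 * (∑ p, ∑ q, I i j p q * I k l p q + 2 * (∑ p, ∑ q, I i p k q * I j p l q
        - ∑ p, ∑ q, I i p l q * I j p k q)) := by
    simp only [hamiltonFun, Pi.sub_apply, Pi.smul_apply, smul_eq_mul, Finset.mul_sum,
      ← Finset.sum_add_distrib, ← Finset.sum_sub_distrib]
    exact Finset.sum_congr rfl fun p _ ↦ Finset.sum_congr rfl fun q _ ↦ by ring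
  rw [main]
  simp only [e1, e2, hρ]
  simp only [hI, sum_unitCurv_mul, sum_unitCurv_mul_swap, sum_unitCurv, hρ]
  rw [← hI]
  have b1 := hR.2.2.2 i j k l
  have p1 := hR.2.2.1 k l i j
  have p2 := hR.2.1 i j l k
  have p3 := hR.2.1 k l j i
  have p4 : R j k l i = R i l k j := by
    rw [hR.2.2.1 j k l i, hR.1 l i, hR.2.1 i l, neg_neg]
  have p5 : R j l k i = R i k l j := by
    rw [hR.2.2.1 j l k i, hR.1 k i, hR.2.1 i k, neg_neg]
  have p6 : R i l k j = - R i l j k := hR.2.1 ..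
  have q1 : I i j l k = - I i j k l := hIm.2.1 ..
  have q2 : I i l k j = - I i l j k := hIm.2.1 ..
  have q3 := hIm.2.2.2 i j k l
  have d : I i j k l = (if i = k then 1 else 0) * (if j = l then 1 else 0)
      - (if i = l then 1 else 0) * (if j = k then 1 else 0) := rfl
  have h1 : ∀ c : ℝ, (if i = k then if j = l then c else 0 else 0)
      - (if i = l then if j = k then c else 0 else 0) = c * I i j k l := fun c ↦ by
    rw [d]; split_ifs <;> simp
  have h2 : ∀ c : ℝ, (if j = l then if i = k then c else 0 else 0)
      - (if j = k then if i = l then c else 0 else 0) = c * I i j k l := fun c ↦ by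
    rw [d]; split_ifs <;> simp
  rw [p4, p5, p6, p1, p2, p3, p1, q1, q2]
  linear_combination (-2 * κ) * h1 ρ - 2 * κ * h2 ρ + 2 * κ ^ 2 * h2 (n - 1) - 4 * κ * b1
    + 2 * κ ^ 2 * q3

end Unit

/-! ### Invariant cones and their supporting functionals -/

/-- Hahn–Banach separates `S` from the interior. Scaling `S` by `2` and `1/2` inside the cone forces
the value `0` at `S`; a nonzero functional has no local extremum at `I`, whence strict positivity.
-/
theorem exists_supporting_functional {V : Type*} [NormedAddCommGroup V] [NormedSpace ℝ V]
    {C : Set V} (hcone : ∀ t : ℝ, 0 < t → ∀ R ∈ C, t • R ∈ C) (hconvex : Convex ℝ C)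
    {S I : V} (hS : S ∈ C) (hS' : S ∉ interior C) (hI : I ∈ interior C) :
    ∃ f : V →L[ℝ] ℝ, (∀ R ∈ C, 0 ≤ f R) ∧ f S = 0 ∧ 0 < f I := by
  obtain ⟨f, hf, hle⟩ := geometric_hahn_banach_of_nonempty_interior_point hconvex hS' ⟨I, hI⟩
  have h0 : f S = 0 := by
    have h1 := hle _ (hcone 2 two_pos S hS)
    have h2 := hle _ (hcone (1 / 2) one_half_pos S hS)
    rw [map_smul, smul_eq_mul] at h1 h2
    linarith
  rw [h0] at hle
  refine ⟨-f, fun R hR ↦ by simpa using hle R hR, by simpa using h0, ?_⟩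
  rw [neg_apply, neg_pos]
  refine lt_of_le_of_ne (hle I (interior_subset hI)) fun h ↦ hf ?_
  have hmax : IsLocalMax f I := by
    filter_upwards [mem_interior_iff_mem_nhds.1 hI] with R hR
    rw [h]; exact hle R hR
  exact hmax.hasFDerivAt_eq_zero f.hasFDerivAt

theorem nonneg_of_hasDerivAt_of_nonneg {f : ℝ → ℝ} {c T : ℝ} (hT : 0 < T)
    (hf : HasDerivAt f c 0) (h0 : f 0 = 0) (hpos : ∀ t ∈ Set.Icc 0 T, 0 ≤ f t) : 0 ≤ c := by
  have h := (hasDerivWithinAt_iff_tendsto_slope' (Set.self_notMem_Ioi)).1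
    (hf.hasDerivWithinAt (s := Set.Ioi 0))
  refine ge_of_tendsto h ?_
  filter_upwards [Ioo_mem_nhdsGT hT] with t ht
  rw [slope_def_field, h0, sub_zero, sub_zero]
  exact div_nonneg (hpos t ⟨ht.1.le, ht.2.le⟩) ht.1.le

/-- First and second order conditions for a nonnegative function at a zero. -/
theorem deriv_conditions_of_nonneg {f f' : ℝ → ℝ} {c : ℝ} (hpos : ∀ᶠ t in 𝓝 0, 0 ≤ f t)
    (h0 : f 0 = 0) (hf : ∀ᶠ t in 𝓝 0, HasDerivAt f (f' t) t) (hf' : HasDerivAt f' c 0) :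
    f' 0 = 0 ∧ 0 ≤ c := by
  have hmin : IsLocalMin f 0 := by
    filter_upwards [hpos] with t ht
    rwa [h0]
  have h1 : f' 0 = 0 := hmin.hasDerivAt_eq_zero hf.self_of_nhds
  refine ⟨h1, ?_⟩
  -- If `c < 0`, the second derivative test makes `0` a local maximum as well; then `f` vanishes
  -- near `0` and `c = 0`.
  by_contra! hc
  have hd : deriv f =ᶠ[𝓝 0] f' := hf.mono fun t ht ↦ ht.deriv
  have hdd : deriv (deriv f) 0 = c := by rw [hd.deriv_eq, hf'.deriv]
  have hmax : IsLocalMax f 0 := isLocalMax_of_deriv_deriv_neg (by rwa [hdd])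
    (by rw [hd.self_of_nhds, h1]) hf.self_of_nhds.continuousAt
  have hz : f =ᶠ[𝓝 0] fun _ ↦ 0 := by
    filter_upwards [hmax, hpos] with t ht ht'
    rw [h0] at ht
    exact le_antisymm ht ht'
  have hz' : f' =ᶠ[𝓝 0] fun _ ↦ 0 := by
    filter_upwards [hz.eventuallyEq_nhds, hf] with t ht ht'
    rw [← ht'.deriv, ht.deriv_eq, deriv_const]
  exact hc.ne (by rw [← hf'.deriv, hz'.deriv_eq, deriv_const])

variable {n : ℕ}

theorem exists_algCurv_projection (n : ℕ) :
    ∃ P : (Fin n → Fin n → Fin n → Fin n → ℝ) →L[ℝ] algCurv n, ∀ R : algCurv n, P R.1 = R := by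
  obtain ⟨P, hP⟩ := (algCurv n).subtype.exists_leftInverse_of_injective (Submodule.ker_subtype _)
  exact ⟨LinearMap.toContinuousLinearMap P, fun R ↦ LinearMap.congr_fun hP R⟩

/-- Gives local solvability of the Hamilton ODE. The projection `P` lets smoothness be checked on
components. -/
theorem contDiff_hamiltonQ : ContDiff ℝ 1 (hamiltonQ (n := n)) := by
  obtain ⟨P, hP⟩ := exists_algCurv_projection n
  have h : (hamiltonQ (n := n)) = fun R ↦ P (hamiltonFun ((algCurv n).subtypeL R)) := by
    ext1 R
    exact (hP (hamiltonQ R)).symm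
  rw [h]
  refine P.contDiff.comp ?_
  have hc : ∀ i j k l, ContDiff ℝ 1 fun R : algCurv n ↦ (algCurv n).subtypeL R i j k l :=
    fun i j k l ↦ by
      have := (algCurv n).subtypeL.contDiff (n := 1)
      fun_prop
  refine contDiff_pi.2 fun i ↦ contDiff_pi.2 fun j ↦ contDiff_pi.2 fun k ↦ contDiff_pi.2 fun l ↦ ?_
  unfold hamiltonFun
  fun_prop

/-- The vector field of an invariant ODE points into the cone. -/
theorem hamiltonQ_nonneg {C : Set (algCurv n)} (hode : IsHamiltonInvariant C)
    {f : algCurv n →L[ℝ] ℝ} (hf : ∀ R ∈ C, 0 ≤ f R) {S : algCurv n} (hS : S ∈ C) (h0 : f S = 0) :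
    0 ≤ f (hamiltonQ S) := by
  -- A solution starting at `S` stays in `C`, so `f` along it is nonnegative and starts at `0`.
  -- Halving `ε` puts the closed interval inside the open interval of existence.
  obtain ⟨R, hR0, ε, hε, hR⟩ := (contDiff_hamiltonQ (n := n)).contDiffAt (x := S)
    |>.exists_forall_mem_closedBall_exists_eq_forall_mem_Ioo_hasDerivAt₀ 0
  have hmem : ∀ t ∈ Set.Icc 0 (ε / 2), t ∈ Set.Ioo (0 - ε) (0 + ε) := fun t ht ↦
    ⟨by linarith [ht.1], by linarith [ht.2]⟩
  have hC := hode (ε / 2) R (fun t ht ↦ (hR t (hmem t ht)).hasDerivWithinAt) (hR0 ▸ hS)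
  have hd : HasDerivAt (fun t ↦ f (R t)) (f (hamiltonQ S)) 0 := by
    have := f.hasFDerivAt.comp_hasDerivAt 0 (hR 0 ⟨by linarith, by linarith⟩)
    rwa [hR0] at this
  exact nonneg_of_hasDerivAt_of_nonneg (half_pos hε) hd (by rw [hR0, h0]) fun t ht ↦
    hf _ (hC t ht)

/-! ### Rotations -/

theorem rotateFun_sub (A : Matrix (Fin n) (Fin n) ℝ) (S T : Fin n → Fin n → Fin n → Fin n → ℝ) :
    rotateFun A (S - T) = rotateFun A S - rotateFun A T := by
  ext i j k l
  simp only [rotateFun, Pi.sub_apply, mul_sub, Finset.sum_sub_distrib]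

theorem rotateFun_smul (A : Matrix (Fin n) (Fin n) ℝ) (c : ℝ)
    (T : Fin n → Fin n → Fin n → Fin n → ℝ) : rotateFun A (c • T) = c • rotateFun A T := by
  ext i j k l
  simp only [rotateFun, Pi.smul_apply, smul_eq_mul, mul_left_comm _ c, Finset.mul_sum]

theorem rotateFun_one (T : Fin n → Fin n → Fin n → Fin n → ℝ) : rotateFun 1 T = T := by
  ext i j k l
  simp [rotateFun, Matrix.one_apply]

theorem rotateFun_unitCurv {A : Matrix (Fin n) (Fin n) ℝ}
    (hA : A ∈ Matrix.orthogonalGroup (Fin n) ℝ) :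
    rotateFun A (unitCurv n).1 = (unitCurv n).1 := by
  have h : ∀ i k, ∑ a, A i a * A k a = if i = k then 1 else 0 := fun i k ↦ by
    have := congrFun (congrFun ((Matrix.mem_orthogonalGroup_iff (Fin n) ℝ).1 hA) i) k
    simpa [Matrix.mul_apply, Matrix.one_apply, Matrix.star_eq_conjTranspose] using this
  ext i j k l
  have e : (unitCurv n).1 i j k l = (∑ a, A i a * A k a) * (∑ b, A j b * A l b)
      - (∑ a, A i a * A l a) * ∑ b, A j b * A k b := by
    simp only [h]; rfl
  rw [e]
  simp only [Finset.sum_mul_sum, ← Finset.sum_sub_distrib]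
  refine Finset.sum_congr rfl fun a _ ↦ Finset.sum_congr rfl fun b _ ↦ ?_
  simp [unitCurv, mul_sub, Finset.sum_sub_distrib]
  ring

/-- The infinitesimal form of `rotateFun_unitCurv`: `I` is fixed by rotations. -/
theorem act_unitCurv {B : Fin n → Fin n → ℝ} (hB : ∀ i j, B i j = -B j i) :
    act B (unitCurv n).1 = 0 := by
  ext i j k l
  simp only [act, Finset.sum_add_distrib, unitCurv, mul_sub, Finset.sum_sub_distrib]
  simp
  rw [hB k i, hB l j, hB k j, hB l i]
  split_ifs <;> ring

theorem sum_swap₃ {f : Fin n → Fin n → Fin n → ℝ} :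
    ∑ a, ∑ d, ∑ e, f a d e = ∑ a, ∑ d, ∑ e, f e d a := by
  rw [Finset.sum_comm, Finset.sum_congr rfl fun d _ ↦ Finset.sum_comm, Finset.sum_comm]

theorem sum_swap₄ {f : Fin n → Fin n → Fin n → Fin n → ℝ} :
    ∑ a, ∑ c, ∑ d, ∑ e, f a c d e = ∑ a, ∑ c, ∑ d, ∑ e, f e c d a := by
  rw [Finset.sum_comm, Finset.sum_congr rfl fun d _ ↦ sum_swap₃, Finset.sum_comm]

theorem sum_swap₅ {f : Fin n → Fin n → Fin n → Fin n → Fin n → ℝ} :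
    ∑ a, ∑ b, ∑ c, ∑ d, ∑ e, f a b c d e = ∑ a, ∑ b, ∑ c, ∑ d, ∑ e, f e b c d a := by
  rw [Finset.sum_comm, Finset.sum_congr rfl fun d _ ↦ sum_swap₄, Finset.sum_comm]

/-- The right-hand side is the Leibniz expansion of a rotation whose matrix has derivative `A * B`;
it feeds `hasDerivAt_rotateFun`. -/
theorem rotateFun_act (A B : Matrix (Fin n) (Fin n) ℝ)
    (T : Fin n → Fin n → Fin n → Fin n → ℝ) (i j k l : Fin n) :
    rotateFun A (act B T) i j k l = ∑ a, ∑ b, ∑ c, ∑ d,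
      ((A * B) i a * A j b * A k c * A l d + A i a * (A * B) j b * A k c * A l d
        + A i a * A j b * (A * B) k c * A l d + A i a * A j b * A k c * (A * B) l d)
      * T a b c d := by
  simp only [rotateFun, act, Matrix.mul_apply, mul_add, add_mul, Finset.sum_add_distrib,
    Finset.mul_sum, Finset.sum_mul]
  congr 1
  · congr 1
    · congr 1
      · rw [sum_swap₅]
        exact Finset.sum_congr rfl fun a _ ↦ Finset.sum_congr rfl fun b _ ↦
          Finset.sum_congr rfl fun c _ ↦ Finset.sum_congr rfl fun d _ ↦
          Finset.sum_congr rfl fun e _ ↦ by ring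
      · refine Finset.sum_congr rfl fun a _ ↦ ?_
        rw [sum_swap₄]
        exact Finset.sum_congr rfl fun b _ ↦
          Finset.sum_congr rfl fun c _ ↦ Finset.sum_congr rfl fun d _ ↦
          Finset.sum_congr rfl fun e _ ↦ by ring
    · refine Finset.sum_congr rfl fun a _ ↦ Finset.sum_congr rfl fun b _ ↦ ?_
      rw [sum_swap₃]
      exact Finset.sum_congr rfl fun c _ ↦ Finset.sum_congr rfl fun d _ ↦
          Finset.sum_congr rfl fun e _ ↦ by ring
  · refine Finset.sum_congr rfl fun a _ ↦ Finset.sum_congr rfl fun b _ ↦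
      Finset.sum_congr rfl fun c _ ↦ ?_
    rw [Finset.sum_comm]
    exact Finset.sum_congr rfl fun d _ ↦ Finset.sum_congr rfl fun e _ ↦ by ring

theorem rotateFun_add (A : Matrix (Fin n) (Fin n) ℝ) (S T : Fin n → Fin n → Fin n → Fin n → ℝ) :
    rotateFun A (S + T) = rotateFun A S + rotateFun A T := by
  ext i j k l
  simp only [rotateFun, Pi.add_apply, mul_add, Finset.sum_add_distrib]

theorem hasDerivAt_rotateFun {A : ℝ → Matrix (Fin n) (Fin n) ℝ} {B : Matrix (Fin n) (Fin n) ℝ}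
    {W : ℝ → Fin n → Fin n → Fin n → Fin n → ℝ} {W' : Fin n → Fin n → Fin n → Fin n → ℝ} {t : ℝ}
    (hA : ∀ i j, HasDerivAt (fun s ↦ A s i j) ((A t * B) i j) t) (hW : HasDerivAt W W' t) :
    HasDerivAt (fun s ↦ rotateFun (A s) (W s)) (rotateFun (A t) (act B (W t) + W')) t := by
  have hW4 : ∀ a b c d, HasDerivAt (fun s ↦ W s a b c d) (W' a b c d) t := fun a b c d ↦
    hasDerivAt_pi.1 (hasDerivAt_pi.1 (hasDerivAt_pi.1 (hasDerivAt_pi.1 hW a) b) c) d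
  refine hasDerivAt_pi.2 fun i ↦ hasDerivAt_pi.2 fun j ↦ hasDerivAt_pi.2 fun k ↦
    hasDerivAt_pi.2 fun l ↦ ?_
  have h : HasDerivAt (fun s ↦ rotateFun (A s) (W s) i j k l) _ t :=
    HasDerivAt.fun_sum fun a _ ↦ HasDerivAt.fun_sum fun b _ ↦ HasDerivAt.fun_sum fun c _ ↦
      HasDerivAt.fun_sum fun d _ ↦
        ((((hA i a).mul (hA j b)).mul (hA k c)).mul (hA l d)).mul (hW4 a b c d)
  refine h.congr_deriv ?_
  rw [rotateFun_add]
  simp only [Pi.add_apply, rotateFun_act]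
  simp only [rotateFun, ← Finset.sum_add_distrib, Pi.mul_apply]
  exact Finset.sum_congr rfl fun a _ ↦ Finset.sum_congr rfl fun b _ ↦
    Finset.sum_congr rfl fun c _ ↦ Finset.sum_congr rfl fun d _ ↦ by ring

theorem hasDerivAt_exp_smul_apply (B : Matrix (Fin n) (Fin n) ℝ) (t : ℝ) (i j : Fin n) :
    HasDerivAt (fun s : ℝ ↦ NormedSpace.exp (s • B) i j) ((NormedSpace.exp (t • B) * B) i j) t := by
  -- The norm is chosen only inside the proof; the entrywise statement does not depend on it.
  let _ := Matrix.linftyOpNormedRing (n := Fin n) (α := ℝ)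
  let _ := Matrix.linftyOpNormedAlgebra (n := Fin n) (R := ℝ) (α := ℝ)
  have h := hasDerivAt_exp_smul_const (𝕂 := ℝ) B t
  have hL := (Matrix.entryLinearMap ℝ ℝ i j).toContinuousLinearMap.hasFDerivAt
    (x := NormedSpace.exp (t • B))
  exact hL.comp_hasDerivAt t h

theorem exp_smul_mem_orthogonalGroup {B : Matrix (Fin n) (Fin n) ℝ} (hB : ∀ i j, B i j = -B j i)
    (t : ℝ) : NormedSpace.exp (t • B) ∈ Matrix.orthogonalGroup (Fin n) ℝ := by
  have hT : (t • B).transpose = -(t • B) := by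
    ext i j
    simp [hB j i]
  rw [Matrix.mem_orthogonalGroup_iff]
  rw [← Matrix.exp_transpose, hT, Matrix.exp_neg]
  exact Matrix.mul_nonsing_inv _ ((Matrix.isUnit_iff_isUnit_det _).1 (Matrix.isUnit_exp _))

/-- First and second order conditions at a zero of a functional which is nonnegative along a
rotated curve of curvature tensors. -/
theorem rotated_curve_conditions {B : Matrix (Fin n) (Fin n) ℝ}
    {W W' : ℝ → Fin n → Fin n → Fin n → Fin n → ℝ} {W'' : Fin n → Fin n → Fin n → Fin n → ℝ}
    (f : (Fin n → Fin n → Fin n → Fin n → ℝ) →L[ℝ] ℝ)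
    (hpos : ∀ᶠ t in 𝓝 (0 : ℝ), 0 ≤ f (rotateFun (NormedSpace.exp (t • B)) (W t)))
    (h0 : f (W 0) = 0) (hW : ∀ᶠ t in 𝓝 0, HasDerivAt W (W' t) t) (hW' : HasDerivAt W' W'' 0) :
    f (act B (W 0) + W' 0) = 0 ∧
      0 ≤ f (act B (act B (W 0) + W' 0) + (act B (W' 0) + W'')) := by
  have hact : HasDerivAt (fun t ↦ act B (W t) + W' t) (act B (W' 0) + W'') 0 := by
    refine HasDerivAt.fun_add ?_ hW'
    have hW4 : ∀ a b c d, HasDerivAt (fun s ↦ W s a b c d) (W' 0 a b c d) 0 := fun a b c d ↦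
      hasDerivAt_pi.1 (hasDerivAt_pi.1 (hasDerivAt_pi.1 (hasDerivAt_pi.1 hW.self_of_nhds a) b) c) d
    refine hasDerivAt_pi.2 fun i ↦ hasDerivAt_pi.2 fun j ↦ hasDerivAt_pi.2 fun k ↦
      hasDerivAt_pi.2 fun l ↦ HasDerivAt.fun_sum fun a _ ↦ ?_
    exact ((((hW4 _ _ _ _).const_mul _).add ((hW4 _ _ _ _).const_mul _)).add
      ((hW4 _ _ _ _).const_mul _)).add ((hW4 _ _ _ _).const_mul _)
  have hf : ∀ᶠ t in 𝓝 0, HasDerivAt (fun t ↦ f (rotateFun (NormedSpace.exp (t • B)) (W t)))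
      (f (rotateFun (NormedSpace.exp (t • B)) (act B (W t) + W' t))) t := hW.mono fun t ht ↦
    f.hasFDerivAt.comp_hasDerivAt t
      (hasDerivAt_rotateFun (fun i j ↦ hasDerivAt_exp_smul_apply B t i j) ht)
  have hf' := f.hasFDerivAt.comp_hasDerivAt 0
    (hasDerivAt_rotateFun (fun i j ↦ hasDerivAt_exp_smul_apply B 0 i j) hact)
  have := deriv_conditions_of_nonneg hpos (by simpa [rotateFun_one] using h0) hf hf'
  simpa [rotateFun_one] using this


/-! ### The maximum principle -/

section MaximumPrinciple

variable {E : Type*} [NormedAddCommGroup E] [NormedSpace ℝ E]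
  {M : Type*} [TopologicalSpace M] [ChartedSpace E M] [IsManifold 𝓘(ℝ, E) ∞ M]
  [FiniteDimensional ℝ E] {g : Metric E M} {n : ℕ}

theorem hasDerivAt_comp_integralCurve {γ : ℝ → M} {X : Π x : M, TangentSpace 𝓘(ℝ, E) x} {t : ℝ}
    {h : M → ℝ} (hγ : HasMFDerivAt 𝓘(ℝ, ℝ) 𝓘(ℝ, E) γ t ((1 : ℝ →L[ℝ] ℝ).smulRight (X (γ t))))
    (hh : MDiffAt h (γ t)) : HasDerivAt (fun s ↦ h (γ s)) (d% h (γ t) (X (γ t))) t := by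
  have h1 : HasFDerivAt (h ∘ γ) (_ : ℝ →L[ℝ] ℝ) t :=
    hasMFDerivAt_iff_hasFDerivAt.1 (hh.hasMFDerivAt.comp t hγ)
  refine h1.hasDerivAt.congr_deriv ?_
  change mfderiv 𝓘(ℝ, E) 𝓘(ℝ) h (γ t) ((1 : ℝ) • X (γ t)) = mfderiv 𝓘(ℝ, E) 𝓘(ℝ) h (γ t) (X (γ t))
  rw [one_smul]

theorem act_smul_right (c : ℝ) (B : Fin n → Fin n → ℝ) (T : Fin n → Fin n → Fin n → Fin n → ℝ) :
    act B (c • T) = c • act B T := by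
  ext i j k l
  simp only [act, Pi.smul_apply, smul_eq_mul, Finset.mul_sum]
  exact Finset.sum_congr rfl fun a _ ↦ by ring

theorem act_neg_right (B : Fin n → Fin n → ℝ) (T : Fin n → Fin n → Fin n → Fin n → ℝ) :
    act B (-T) = -act B T := by
  rw [← neg_one_smul ℝ T, act_smul_right, neg_one_smul]

/-- The Laplacian of the curvature tensor of an Einstein metric, tested with a functional which
supports a rotation invariant set at the curvature tensor. -/
theorem IsOrthonormalFrameOn.nonneg_laplacian {U : Set M}
    {e : Fin n → Π x : M, TangentSpace 𝓘(ℝ, E) x} (he : IsOrthonormalFrameOn g U e) {ρ : ℝ}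
    (hR : ∀ y ∈ U, curvatureComponents g y (fun i ↦ e i y) ∈ algCurv n)
    (hρ : ∀ y ∈ U, ∀ u v : TangentSpace 𝓘(ℝ, E) y,
      ∑ i, riemann g y u (e i y) v (e i y) = ρ * g.inner y u v) {p : M} (hp : p ∈ U) {κ : ℝ}
    (f : (Fin n → Fin n → Fin n → Fin n → ℝ) →L[ℝ] ℝ)
    (hf : ∀ y ∈ U, ∀ A ∈ Matrix.orthogonalGroup (Fin n) ℝ, 0 ≤
      f (rotateFun A (curvatureComponents g y (fun i ↦ e i y) - κ • (unitCurv n).1)))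
    (hf0 : f (curvatureComponents g p (fun i ↦ e i p) - κ • (unitCurv n).1) = 0) :
    0 ≤ f ((2 * ρ) • curvatureComponents g p (fun i ↦ e i p)
      - hamiltonFun (curvatureComponents g p (fun i ↦ e i p))) := by
  set R : M → Fin n → Fin n → Fin n → Fin n → ℝ :=
    fun y ↦ curvatureComponents g y fun i ↦ e i y with hRdef
  set Γ : Fin n → Fin n → Fin n → ℝ := fun i j k ↦ koszul g (e i) (e j) (e k) p with hΓ
  set DR : Fin n → Fin n → Fin n → Fin n → Fin n → ℝ :=
    fun m i j k l ↦ d% (fun y ↦ R y i j k l) p (e m p) with hDR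
  set DDR : Fin n → Fin n → Fin n → Fin n → Fin n → ℝ :=
    fun m i j k l ↦ d% (fun y ↦ d% (fun y ↦ R y i j k l) y (e m y)) p (e m p) with hDDR
  set DΓ : Fin n → Fin n → Fin n → ℝ :=
    fun m i j ↦ d% (koszul g (e m) (e i) (e j)) p (e m p) with hDΓ
  have hRs : ∀ i j k l, SmoothFunOn E U fun y ↦ R y i j k l := fun i j k l ↦
    he.smooth_riemann i j k l
  have hΓskew : ∀ m i j, Γ m i j = -Γ m j i := fun m i j ↦ he.koszul_skew hp m i j
  have hDΓskew : ∀ m i j, DΓ m i j = -DΓ m j i := fun m i j ↦ by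
    have h : d% (koszul g (e m) (e i) (e j)) p = d% (-koszul g (e m) (e j) (e i)) p :=
      mvfderiv_congr_of_eqOn he.isOpen (fun y hy ↦ he.koszul_skew hy m i j) hp
    simp only [hDΓ, h]
    rw [mvfderiv_neg]
    simp
  have hact : ∀ B : Fin n → Fin n → ℝ, (∀ i j, B i j = -B j i) →
      act B (R p - κ • (unitCurv n).1) = act B (R p) := fun B hB ↦ by
    rw [act_sub_right, act_smul_right, act_unitCurv hB, smul_zero, sub_zero]
  have horth : ∀ B : Matrix (Fin n) (Fin n) ℝ, (∀ i j, B i j = -B j i) → ∀ t : ℝ, ∀ y ∈ U,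
      0 ≤ f (rotateFun (NormedSpace.exp (t • B)) (R y - κ • (unitCurv n).1)) :=
    fun B hB t y hy ↦ hf y hy _ (exp_smul_mem_orthogonalGroup hB t)
  -- The first-order condition along the rotation orbit of the tensor at `p`: `f` kills the orbit's
  -- tangent space.
  have hrot : ∀ B : Fin n → Fin n → ℝ, (∀ i j, B i j = -B j i) → f (act B (R p)) = 0 :=
    fun B hB ↦ by
    have := (rotated_curve_conditions (B := B) (W := fun _ ↦ R p - κ • (unitCurv n).1)
      (W' := fun _ ↦ 0) (W'' := 0) f (.of_forall fun t ↦ horth B hB t p hp) hf0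
      (.of_forall fun t ↦ hasDerivAt_const ..) (hasDerivAt_const ..)).1
    rwa [add_zero, hact B hB] at this
  have hneg : ∀ m, ∀ i j, (-Γ m) i j = -(-Γ m) j i := fun m i j ↦ by
    simp only [Pi.neg_apply, hΓskew m i j]
  -- Along an integral curve of `e m`, rotating by `exp(-tΓ m)` with `Γ` frozen at `p` replaces
  -- parallel transport. The variation of `Γ` along the curve enters only through `act (DΓ m)`,
  -- which `hrot` annihilates.
  have hcurve : ∀ m, f (DR m) = 0 ∧
      0 ≤ f (act (Γ m) (act (Γ m) (R p)) - (2 : ℝ) • act (Γ m) (DR m) + DDR m) := by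
    intro m
    have hone : (1 : ℕ∞ω) ≤ ∞ := by simp
    obtain ⟨γ, hγ0, hγ⟩ := exists_isMIntegralCurveAt_of_contMDiffAt_boundaryless (I := 𝓘(ℝ, E))
      (t₀ := 0) (v := e m) (x₀ := p) ((he.smooth m p hp).of_le hone)
    have hcont := hγ.continuousAt
    have hU : ∀ᶠ t in 𝓝 (0 : ℝ), γ t ∈ U :=
      hcont.eventually_mem (by rw [hγ0]; exact he.isOpen.mem_nhds hp)
    have h := rotated_curve_conditions (B := -Γ m) (W := fun t ↦ R (γ t) - κ • (unitCurv n).1)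
      (W' := fun t i j k l ↦ d% (fun y ↦ R y i j k l) (γ t) (e m (γ t))) (W'' := DDR m) f
      (hU.mono fun t ht ↦ horth _ (hneg m) t _ ht) (by rw [hγ0]; exact hf0) ?_ ?_
    · have e0 : (fun i j k l ↦ d% (fun y ↦ R y i j k l) (γ 0) (e m (γ 0))) = DR m := by
        rw [hγ0]
      rw [e0, hγ0, hact _ (hneg m)] at h
      have h2 : act (-Γ m) (act (-Γ m) (R p) + DR m) + (act (-Γ m) (DR m) + DDR m) =
          act (Γ m) (act (Γ m) (R p)) - (2 : ℝ) • act (Γ m) (DR m) + DDR m := by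
        simp only [act_neg_left, act_add_right, act_neg_right, two_smul]
        abel
      rw [map_add, hrot _ (hneg m), zero_add, h2] at h
      exact h
    · filter_upwards [hU, hγ] with t ht ht'
      refine HasDerivAt.sub_const _ ?_
      exact hasDerivAt_pi.2 fun i ↦ hasDerivAt_pi.2 fun j ↦ hasDerivAt_pi.2 fun k ↦
        hasDerivAt_pi.2 fun l ↦ hasDerivAt_comp_integralCurve ht' ((hRs i j k l).mdiffAt ht)
    · refine hasDerivAt_pi.2 fun i ↦ hasDerivAt_pi.2 fun j ↦ hasDerivAt_pi.2 fun k ↦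
        hasDerivAt_pi.2 fun l ↦ ?_
      have := hasDerivAt_comp_integralCurve hγ.self_of_nhds
        ((he.smooth_mvfderiv (hRs i j k l) m).mdiffAt hU.self_of_nhds)
      rwa [hγ0] at this
  -- Under `f` only the second-order expression from `hcurve` survives. The curves need not be
  -- geodesics, since the correction by `Γ m m a` multiplies first derivatives, which `f` kills.
  have key : (2 * ρ) • R p - hamiltonFun (R p) = ∑ m, ((act (Γ m) (act (Γ m) (R p))
      - (2 : ℝ) • act (Γ m) (DR m) + DDR m) - act (DΓ m) (R p)
      - ∑ a, Γ m m a • (DR a - act (Γ a) (R p))) := by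
    ext i j k l
    have := he.laplacian_riemann hR hρ hp hRdef hΓ hDR i j k l
    simp only [Pi.sub_apply, Pi.smul_apply, smul_eq_mul, ← this, Finset.sum_apply, Pi.add_apply]
    exact Finset.sum_congr rfl fun m _ ↦ by ring
  rw [key, map_sum]
  refine Finset.sum_nonneg fun m _ ↦ ?_
  rw [map_sub, map_sub, hrot _ (hDΓskew m), map_sum]
  simp only [map_smul, map_sub, hrot _ (hΓskew _), (hcurve _).1]
  simpa using (hcurve m).2

end MaximumPrinciple

/-! ### Curvature tensors shifted by a multiple of the curvature of the sphere -/

/-- A continuous linear projection onto the space of algebraic curvature tensors. -/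
def algCurvProj (n : ℕ) : (Fin n → Fin n → Fin n → Fin n → ℝ) →L[ℝ] algCurv n :=
  (exists_algCurv_projection n).choose

theorem algCurvProj_coe {n : ℕ} (R : algCurv n) : algCurvProj n R.1 = R :=
  (exists_algCurv_projection n).choose_spec R

theorem coe_algCurvProj {n : ℕ} {T : Fin n → Fin n → Fin n → Fin n → ℝ} (hT : T ∈ algCurv n) :
    (algCurvProj n T).1 = T := congrArg Subtype.val (algCurvProj_coe ⟨T, hT⟩)

section Shift

variable {E : Type*} [NormedAddCommGroup E] [NormedSpace ℝ E]
  {M : Type*} [TopologicalSpace M] [ChartedSpace E M] [IsManifold 𝓘(ℝ, E) ∞ M]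
  [FiniteDimensional ℝ E] (g : Metric E M) {n : ℕ}

/-- The curvature tensor at `x` in a frame `e`, minus `κ` times the curvature tensor of the
unit sphere. -/
def shiftedCurv (κ : ℝ) (x : M) (e : Fin n → TangentSpace 𝓘(ℝ, E) x) : algCurv n :=
  algCurvProj n (curvatureComponents g x e) - κ • unitCurv n

variable {g}

theorem curvatureComponents_eq_rotateFun [NeZero n] (hn : Module.finrank ℝ E = n) {x : M}
    {b e : Fin n → TangentSpace 𝓘(ℝ, E) x} (hb : IsOrthonormalFrame g x b)
    (he : IsOrthonormalFrame g x e) : ∃ A ∈ Matrix.orthogonalGroup (Fin n) ℝ,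
      curvatureComponents g x e = rotateFun A (curvatureComponents g x b) := by
  -- The change-of-basis matrix; its orthogonality is Parseval's identity in the basis `b`.
  refine ⟨Matrix.of fun i a ↦ g.inner x (e i) (b a), ?_, ?_⟩
  · rw [Matrix.mem_orthogonalGroup_iff]
    ext i j
    rw [Matrix.mul_apply, Matrix.one_apply, ← he i j]
    conv_rhs => rw [← hb.sum_inner_smul hn (e j)]
    simp only [map_sum, map_smul, smul_eq_mul]
    exact Finset.sum_congr rfl fun a _ ↦ mul_comm _ _
  · obtain ⟨U, b', hx, hb', hbb⟩ := exists_isOrthonormalFrameOn hn hb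
    ext i j k l
    have := riemann_eq_sum hb' hx (e i) (e j) (e k) (e l)
    simp only [hbb] at this
    exact this

/-- Rotations fix `I`, so the shift commutes with a change of frame; for invariant `C`, membership
does not depend on the frame. -/
theorem shiftedCurv_eq_rotate [NeZero n] (hn : Module.finrank ℝ E = n) {x : M}
    {b e : Fin n → TangentSpace 𝓘(ℝ, E) x} (hb : IsOrthonormalFrame g x b)
    (he : IsOrthonormalFrame g x e) (hR : curvatureComponents g x b ∈ algCurv n) (κ : ℝ) :
    ∃ A ∈ Matrix.orthogonalGroup (Fin n) ℝ,
      shiftedCurv g κ x e = rotate A (shiftedCurv g κ x b) := by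
  obtain ⟨A, hA, h⟩ := curvatureComponents_eq_rotateFun hn hb he
  refine ⟨A, hA, Subtype.ext ?_⟩
  have h1 : (shiftedCurv g κ x e).1 =
    (algCurvProj n (curvatureComponents g x e)).1 - κ • (unitCurv n).1 := rfl
  have h2 : (rotate A (shiftedCurv g κ x b)).1 =
    rotateFun A ((algCurvProj n (curvatureComponents g x b)).1 - κ • (unitCurv n).1) := rfl
  rw [h1, h2, h, coe_algCurvProj hR, coe_algCurvProj (rotateFun_mem A hR), rotateFun_sub,
    rotateFun_smul, rotateFun_unitCurv hA]

/-- If all curvature tensors lie in the interior of an invariant set, then they can be shifted a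
little further without leaving the set. -/
theorem exists_shiftedCurv_mem [NeZero n] [CompactSpace M] (hn : Module.finrank ℝ E = n)
    {C : Set (algCurv n)} (hinv : ∀ A ∈ Matrix.orthogonalGroup (Fin n) ℝ, ∀ R ∈ C, rotate A R ∈ C)
    (hR : ∀ (x : M) (e : Fin n → TangentSpace 𝓘(ℝ, E) x), IsOrthonormalFrame g x e →
      curvatureComponents g x e ∈ algCurv n) {κ : ℝ}
    (hC : ∀ (x : M) (e : Fin n → TangentSpace 𝓘(ℝ, E) x), IsOrthonormalFrame g x e →
      shiftedCurv g κ x e ∈ interior C) :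
    ∃ κ' > κ, ∀ (x : M) (e : Fin n → TangentSpace 𝓘(ℝ, E) x), IsOrthonormalFrame g x e →
      shiftedCurv g κ' x e ∈ C := by
  have h : ∀ᶠ κ' in 𝓝 κ, ∀ x ∈ (Set.univ : Set M), ∀ e : Fin n → TangentSpace 𝓘(ℝ, E) x,
      IsOrthonormalFrame g x e → shiftedCurv g κ' x e ∈ C := by
    -- By compactness it suffices to work near each `(κ, x)`. There a smooth frame gives a
    -- continuous shifted curvature, and every other frame is reached by a rotation.
    refine isCompact_univ.eventually_forall_of_forall_eventually fun x _ ↦ ?_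
    obtain ⟨b, hb⟩ := exists_isOrthonormalFrame g hn x
    obtain ⟨U, e, hx, he, -⟩ := exists_isOrthonormalFrameOn hn hb
    have hcont : ContinuousAt (fun z : ℝ × M ↦ shiftedCurv g z.1 z.2 fun i ↦ e i z.2) (κ, x) := by
      have h1 : ContinuousAt (fun y ↦ curvatureComponents g y fun i ↦ e i y) x :=
        continuousAt_pi.2 fun i ↦ continuousAt_pi.2 fun j ↦ continuousAt_pi.2 fun k ↦
          continuousAt_pi.2 fun l ↦ (he.smooth_riemann i j k l x hx).continuousAt
      have h2 : ContinuousAt (fun z : ℝ × M ↦ curvatureComponents g z.2 fun i ↦ e i z.2) (κ, x) :=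
        ContinuousAt.comp (f := Prod.snd) (x := (κ, x)) h1 continuousAt_snd
      exact ((algCurvProj n).continuous.continuousAt.comp h2).sub
        (continuousAt_fst.smul continuousAt_const)
    filter_upwards [hcont (mem_interior_iff_mem_nhds.1 (hC x _ (he.orthonormal x hx))),
      continuousAt_snd (p := (κ, x)) (he.isOpen.mem_nhds hx)] with z hz hzU f hf
    obtain ⟨A, hA, h⟩ := shiftedCurv_eq_rotate hn (he.orthonormal z.2 hzU) hf
      (hR _ _ (he.orthonormal z.2 hzU)) z.1
    rw [h]
    exact hinv A hA _ hz
  obtain ⟨κ', h1, h2⟩ := (h.filter_mono nhdsWithin_le_nhds).and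
    (self_mem_nhdsWithin (a := κ) (s := Set.Ioi κ)) |>.exists
  exact ⟨κ', h2, fun x e he ↦ h1 x trivial e he⟩

theorem ricci_shiftedCurv {x : M} {e : Fin n → TangentSpace 𝓘(ℝ, E) x}
    (he : IsOrthonormalFrame g x e) (hR : curvatureComponents g x e ∈ algCurv n) {ρ : ℝ}
    (hρ : ∀ u v, ∑ i, riemann g x u (e i) v (e i) = ρ * g.inner x u v) (κ : ℝ) :
    ricci (shiftedCurv g κ x e) = (ρ - (n - 1) * κ) • (1 : Matrix (Fin n) (Fin n) ℝ) := by
  ext i k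
  have h : ∀ j, (shiftedCurv g κ x e).1 i j k j =
      curvatureComponents g x e i j k j - κ * (unitCurv n).1 i j k j := fun j ↦ by
    conv_rhs => rw [← coe_algCurvProj hR]
    rfl
  have h' : ∑ j, curvatureComponents g x e i j k j = ρ * if i = k then 1 else 0 := by
    rw [← he i k]; exact hρ _ _
  rw [ricci, Matrix.of_apply, Finset.sum_congr rfl fun j _ ↦ h j, Finset.sum_sub_distrib,
    ← Finset.mul_sum, sum_unitCurv, h', Matrix.smul_apply, Matrix.one_apply, smul_eq_mul]
  split_ifs <;> ring

/-- At a boundary point of the cone, the shift is at least the average sectional curvature. -/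
theorem le_of_shiftedCurv_notMem_interior [NeZero n] (hn : Module.finrank ℝ E = n)
    {C : Set (algCurv n)} (hcone : ∀ t : ℝ, 0 < t → ∀ R ∈ C, t • R ∈ C) (hconvex : Convex ℝ C)
    (hinv : ∀ A ∈ Matrix.orthogonalGroup (Fin n) ℝ, ∀ R ∈ C, rotate A R ∈ C)
    (hode : IsHamiltonInvariant C) (hI : unitCurv n ∈ interior C)
    (hR : ∀ (x : M) (e : Fin n → TangentSpace 𝓘(ℝ, E) x), IsOrthonormalFrame g x e →
      curvatureComponents g x e ∈ algCurv n) {ρ : ℝ}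
    (hρ : ∀ (x : M) (e : Fin n → TangentSpace 𝓘(ℝ, E) x), IsOrthonormalFrame g x e →
      ∀ u v, ∑ i, riemann g x u (e i) v (e i) = ρ * g.inner x u v) {κ : ℝ} (hκ : 0 < κ)
    (hC : ∀ (x : M) (e : Fin n → TangentSpace 𝓘(ℝ, E) x), IsOrthonormalFrame g x e →
      shiftedCurv g κ x e ∈ C) {p : M} {b : Fin n → TangentSpace 𝓘(ℝ, E) p}
    (hb : IsOrthonormalFrame g p b) (hpb : shiftedCurv g κ p b ∉ interior C) :
    ρ ≤ (n - 1) * κ := by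
  obtain ⟨f, hf, hf0, hfI⟩ := exists_supporting_functional hcone hconvex (hC p b hb) hpb hI
  obtain ⟨U, e, hp, he, heb⟩ := exists_isOrthonormalFrameOn hn hb
  have heb' : (fun i ↦ e i p) = b := funext heb
  have hcoe : ∀ y (e : Fin n → TangentSpace 𝓘(ℝ, E) y), IsOrthonormalFrame g y e →
      (shiftedCurv g κ y e).1 = curvatureComponents g y e - κ • (unitCurv n).1 := fun y e he ↦ by
    conv_rhs => rw [← coe_algCurvProj (hR y e he)]
    rfl
  -- The functional must be defined on all arrays, hence the composition with the projection.
  have h1 := he.nonneg_laplacian (κ := κ) (fun y hy ↦ hR y _ (he.orthonormal y hy))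
    (fun y hy ↦ hρ y _ (he.orthonormal y hy)) hp (f.comp (algCurvProj n)) (fun y hy A hA ↦ by
      rw [← hcoe y _ (he.orthonormal y hy)]
      have := hf _ (hinv A hA _ (hC y _ (he.orthonormal y hy)))
      rw [← algCurvProj_coe (rotate A _)] at this
      exact this) (by
      rw [heb', ← hcoe p b hb, ContinuousLinearMap.comp_apply, algCurvProj_coe, hf0])
  rw [heb'] at h1
  have h2 := hamiltonQ_nonneg hode hf (hC p b hb) hf0
  set R := algCurvProj n (curvatureComponents g p b) with hRdef
  have hR1 : R.1 = curvatureComponents g p b := coe_algCurvProj (hR p b hb)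
  have hS : shiftedCurv g κ p b = R - κ • unitCurv n := rfl
  have hQ : hamiltonQ (R - κ • unitCurv n) = hamiltonQ R
      - (4 * κ * ρ) • unitCurv n + (2 * (n - 1) * κ ^ 2) • unitCurv n := by
    refine Subtype.ext ?_
    ext i j k l
    refine hamiltonFun_sub_unitCurv R.2 (ρ := ρ) (fun i k ↦ ?_) κ i j k l
    rw [hR1]
    refine (hρ p b hb (b i) (b k)).trans ?_
    rw [hb i k]
    split_ifs <;> simp
  have h3 : f.comp (algCurvProj n) ((2 * ρ) • curvatureComponents g p b
      - hamiltonFun (curvatureComponents g p b)) = 2 * ρ * f R - f (hamiltonQ R) := by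
    rw [← hR1, map_sub, map_smul, ContinuousLinearMap.comp_apply, ContinuousLinearMap.comp_apply,
      algCurvProj_coe, smul_eq_mul]
    congr 2
    exact algCurvProj_coe (hamiltonQ R)
  rw [h3] at h1
  rw [hS, map_sub, map_smul, smul_eq_mul] at hf0
  rw [hS, hQ, map_add, map_sub, map_smul, map_smul, smul_eq_mul, smul_eq_mul] at h2
  -- The sum of `h1` and `h2`: the terms `f (hamiltonQ R)` cancel, and `2ρκ - 4ρκ + 2(n - 1)κ²`
  -- remains as the coefficient of `f I`.
  have h4 : 0 ≤ 2 * κ * f (unitCurv n) * ((n - 1) * κ - ρ) := by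
    have : f R = κ * f (unitCurv n) := by linarith
    rw [this] at h1
    linarith
  have := nonneg_of_mul_nonneg_right h4 (by positivity)
  linarith

theorem sum_mul_unitCurv (u v : Fin n → ℝ) :
    ∑ i, ∑ j, ∑ k, ∑ l, u i * v j * u k * v l * (unitCurv n).1 i j k l =
      (∑ i, u i ^ 2) * (∑ i, v i ^ 2) - (∑ i, u i * v i) ^ 2 := by
  rw [sq (∑ i, u i * v i)]
  simp only [Finset.sum_mul_sum, ← Finset.sum_sub_distrib]
  refine Finset.sum_congr rfl fun i _ ↦ Finset.sum_congr rfl fun j _ ↦ ?_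
  simp [unitCurv, mul_sub, Finset.sum_sub_distrib]
  ring

theorem hasConstantSectionalCurvature_of_components [NeZero n] (hn : Module.finrank ℝ E = n)
    {κ : ℝ} (h : ∀ (x : M) (e : Fin n → TangentSpace 𝓘(ℝ, E) x), IsOrthonormalFrame g x e →
      curvatureComponents g x e = κ • (unitCurv n).1) : HasConstantSectionalCurvature g := by
  refine ⟨κ, fun x u v huv ↦ ?_⟩
  obtain ⟨b, hb⟩ := exists_isOrthonormalFrame g hn x
  obtain ⟨U, e, hx, he, -⟩ := exists_isOrthonormalFrameOn hn hb
  have hsum : ∀ u v, g.inner x u v = ∑ i, g.inner x u (e i x) * g.inner x v (e i x) :=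
    fun u v ↦ by
    conv_lhs => rw [← (he.orthonormal x hx).sum_inner_smul hn v]
    simp only [map_sum, map_smul, smul_eq_mul]
    exact Finset.sum_congr rfl fun a _ ↦ mul_comm _ _
  have hK : riemann g x u v u v = κ * (g.inner x u u * g.inner x v v - g.inner x u v ^ 2) := by
    have : Nonempty (Fin n) := ⟨0⟩
    have hc : ∀ i j k l, riemann g x (e i x) (e j x) (e k x) (e l x) =
        κ * (unitCurv n).1 i j k l := fun i j k l ↦
      congrFun (congrFun (congrFun (congrFun (h x _ (he.orthonormal x hx)) i) j) k) l
    rw [riemann_eq_sum he hx u v u v, hsum u u, hsum v v, hsum u v]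
    simp only [hc, ← sq]
    rw [← sum_mul_unitCurv]
    simp only [Finset.mul_sum]
    exact Finset.sum_congr rfl fun i _ ↦ Finset.sum_congr rfl fun j _ ↦
      Finset.sum_congr rfl fun k _ ↦ Finset.sum_congr rfl fun l _ ↦ by ring
  have hpos : 0 < g.inner x u u * g.inner x v v - g.inner x u v ^ 2 := by
    have hu : u ≠ 0 := huv.ne_zero 0
    -- `w` is `|u|²` times the component of `v` orthogonal to `u`, so `|w|²` is `|u|²` times the
    -- Gram determinant.
    set w := g.inner x u u • v - g.inner x u v • u with hw
    have hw0 : w ≠ 0 := fun h0 ↦ by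
      have := LinearIndependent.pair_iff.1 huv (-g.inner x u v) (g.inner x u u) (by
        rw [← h0, hw, neg_smul]; abel)
      exact (g.pos x u hu).ne' this.2
    have h1 := g.pos x w hw0
    have h2 : g.inner x w w =
        g.inner x u u * (g.inner x u u * g.inner x v v - g.inner x u v ^ 2) := by
      rw [hw]
      simp only [map_sub, map_smul, sub_apply, smul_apply, smul_eq_mul, g.symm x v u]
      ring
    rw [h2] at h1
    exact pos_of_mul_pos_right h1 (g.pos x u hu).le
  rw [sectionalCurvature, hK, mul_div_assoc, div_self hpos.ne', mul_one]

end Shift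

/-! ### The extremal shift and the conclusion -/

section Main

variable {E : Type*} [NormedAddCommGroup E] [NormedSpace ℝ E]
  {M : Type*} [TopologicalSpace M] [ChartedSpace E M] [IsManifold 𝓘(ℝ, E) ∞ M]
  [FiniteDimensional ℝ E] {g : Metric E M} {n : ℕ}

theorem isClosed_setOf_shiftedCurv_mem {C : Set (algCurv n)} (hclosed : IsClosed C) (x : M)
    (e : Fin n → TangentSpace 𝓘(ℝ, E) x) : IsClosed {κ : ℝ | shiftedCurv g κ x e ∈ C} :=
  hclosed.preimage (continuous_const.sub (continuous_id.smul continuous_const))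

/-- An Einstein metric whose curvature tensors lie in the interior of an invariant cone has
constant sectional curvature. -/
theorem hasConstantSectionalCurvature [CompactSpace M] (hn : 2 ≤ n)
    (hfr : Module.finrank ℝ E = n) {C : Set (algCurv n)}
    (hcone : ∀ t : ℝ, 0 < t → ∀ R ∈ C, t • R ∈ C) (hclosed : IsClosed C) (hconvex : Convex ℝ C)
    (hinv : ∀ A ∈ Matrix.orthogonalGroup (Fin n) ℝ, ∀ R ∈ C, rotate A R ∈ C)
    (hode : IsHamiltonInvariant C) (hric : ∀ R ∈ C, R ≠ 0 → 0 ≤ scal R ∧ ricci R ≠ 0)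
    (hI : unitCurv n ∈ interior C)
    (hcurv : ∀ (x : M) (e : Fin n → TangentSpace 𝓘(ℝ, E) x), IsOrthonormalFrame g x e →
      ∃ R ∈ interior C, R.1 = curvatureComponents g x e) {ρ : ℝ}
    (hρ : ∀ (x : M) (e : Fin n → TangentSpace 𝓘(ℝ, E) x), IsOrthonormalFrame g x e →
      ∀ u v, ∑ i, riemann g x u (e i) v (e i) = ρ * g.inner x u v) :
    HasConstantSectionalCurvature g := by
  have : NeZero n := ⟨by omega⟩
  have hn1 : (0 : ℝ) < n - 1 := by
    have : (2 : ℝ) ≤ n := by exact_mod_cast hn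
    linarith
  rcases isEmpty_or_nonempty M with hM | ⟨⟨x₀⟩⟩
  · exact ⟨0, fun x ↦ hM.elim x⟩
  obtain ⟨e₀, he₀⟩ := exists_isOrthonormalFrame g hfr x₀
  have hR : ∀ (x : M) (e : Fin n → TangentSpace 𝓘(ℝ, E) x), IsOrthonormalFrame g x e →
      curvatureComponents g x e ∈ algCurv n := fun x e he ↦ by
    obtain ⟨R, -, h⟩ := hcurv x e he
    exact h ▸ R.2
  -- The scalar curvature of the shifted tensor is `n (ρ - (n - 1) κ)`. A single base point
  -- suffices.
  have hscal : ∀ {κ : ℝ}, shiftedCurv g κ x₀ e₀ ∈ C → (n - 1) * κ ≤ ρ := fun {κ} h ↦ by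
    have hs : 0 ≤ scal (shiftedCurv g κ x₀ e₀) := by
      by_cases h0 : shiftedCurv g κ x₀ e₀ = 0
      · rw [h0]; simp [scal, ricci]
      · exact (hric _ h h0).1
    rw [scal, ricci_shiftedCurv he₀ (hR x₀ e₀ he₀) (hρ x₀ e₀ he₀)] at hs
    simp only [Matrix.smul_apply, Matrix.one_apply_eq, smul_eq_mul, mul_one, Finset.sum_const,
      Finset.card_univ, Fintype.card_fin, nsmul_eq_mul] at hs
    have := nonneg_of_mul_nonneg_right hs (by linarith)
    linarith
  let K : Set ℝ := {κ | ∀ (x : M) (e : Fin n → TangentSpace 𝓘(ℝ, E) x),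
    IsOrthonormalFrame g x e → shiftedCurv g κ x e ∈ C}
  have hKclosed : IsClosed K := by
    simp only [K, Set.ofPred_forall]
    exact isClosed_iInter fun x ↦ isClosed_iInter fun e ↦ isClosed_iInter fun _ ↦
      isClosed_setOf_shiftedCurv_mem hclosed x e
  have hKbdd : BddAbove K := ⟨ρ / (n - 1), fun κ hκ ↦ by
    rw [le_div_iff₀ hn1, mul_comm]
    exact hscal (hκ x₀ e₀ he₀)⟩
  -- At shift `0` the tensors are interior by hypothesis, so a positive shift is admissible;
  -- positivity of `sSup K` is needed for the boundary estimate.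
  obtain ⟨κ₀, hκ₀, hK₀⟩ := exists_shiftedCurv_mem hfr hinv hR (κ := 0) (fun x e he ↦ by
    obtain ⟨R, hR, h⟩ := hcurv x e he
    rw [shiftedCurv, ← h, algCurvProj_coe, zero_smul, sub_zero]
    exact hR)
  have hmem : sSup K ∈ K := hKclosed.csSup_mem ⟨κ₀, hK₀⟩ hKbdd
  have hpos : 0 < sSup K := lt_of_lt_of_le hκ₀ (le_csSup hKbdd hK₀)
  set κ := sSup K
  have hle : ρ ≤ (n - 1) * κ := by
    by_contra! hlt
    obtain ⟨κ', hκ', hK'⟩ := exists_shiftedCurv_mem hfr hinv hR (κ := κ) (fun x e he ↦ by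
      by_contra hx
      exact hlt.not_ge (le_of_shiftedCurv_notMem_interior hfr hcone hconvex hinv hode hI hR hρ hpos
        hmem he hx))
    exact hκ'.not_ge (le_csSup hKbdd hK')
  have heq : ρ = (n - 1) * κ := le_antisymm hle (hscal (hmem x₀ e₀ he₀))
  refine hasConstantSectionalCurvature_of_components hfr (κ := κ) fun x e he ↦ ?_
  -- With `ρ = (n - 1) κ` the shifted tensor is Ricci flat, which is impossible for a nonzero
  -- element of `C`.
  have hzero : shiftedCurv g κ x e = 0 := by
    by_contra h0
    refine (hric _ (hmem x e he) h0).2 ?_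
    rw [ricci_shiftedCurv he (hR x e he) (hρ x e he), heq, sub_self, zero_smul]
  have := congrArg Subtype.val (sub_eq_zero.1 hzero)
  rwa [coe_algCurvProj (hR x e he)] at this

end Main
end EinsteinCone

end

theorem theorem3 {n : ℕ} (hn : 4 ≤ n) (C : Set (EinsteinCone.algCurv n))
    (hcone : ∀ t : ℝ, 0 < t → ∀ R ∈ C, t • R ∈ C)
    (hclosed : IsClosed C) (hconvex : Convex ℝ C)
    (hinv : ∀ A ∈ Matrix.orthogonalGroup (Fin n) ℝ, ∀ R ∈ C, EinsteinCone.rotate A R ∈ C)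
    (hode : EinsteinCone.IsHamiltonInvariant C)
    (hric : ∀ R ∈ C, R ≠ 0 → 0 ≤ EinsteinCone.scal R ∧ EinsteinCone.ricci R ≠ 0)
    (hI : EinsteinCone.unitCurv n ∈ interior C)
    {M : Type*} [TopologicalSpace M] [T2Space M] [CompactSpace M]
    [ChartedSpace (EuclideanSpace ℝ (Fin n)) M] [IsManifold (𝓡 n) ∞ M]
    (g : EinsteinCone.Metric (EuclideanSpace ℝ (Fin n)) M)
    (hEinstein : EinsteinCone.IsEinstein g)
    (hcurv : ∀ (x : M) (e : Fin n → TangentSpace (𝓡 n) x), EinsteinCone.IsOrthonormalFrame g x e →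
      ∃ R ∈ interior C, R.1 = EinsteinCone.curvatureComponents g x e) :
    EinsteinCone.HasConstantSectionalCurvature g := by
  obtain ⟨ρ, hρ⟩ := hEinstein
  exact EinsteinCone.hasConstantSectionalCurvature (by omega) (by simp) hcone hclosed hconvex hinv
    hode hric hI hcurv hρ
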